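/- Let $G$ be a compact Hausdorff second countable topological group with Borel $\sigma$-algebra $\mathcal B(G)$, let $\mathcal H$ be a complex separable Hilbert space, and let $U$ be a strongly continuous unitary representation of $G$ on $\mathcal H$. An \emph{observable} is a map $\mathsf E:\mathcal B(G)\to\mathcal L(\mathcal H)$ with $0\le \mathsf E(X)\le I$ for all $X$, $\mathsf E(G)=I$, and $\mathsf E(\bigcup_i X_i)=\sum_i\mathsf E(X_i)$ in the weak operator topology for every sequence $(X_i)$ of pairwise disjoint Borel sets. Let $\mathcal O_U$ be the set of $U$-covariant observables, i.e. those with $U(g)\mathsf E(X)U(g)^*=\mathsf E(gX)$ for all $g\in G$, $X\in\mathcal B(G)$. Call $\mathsf E$ \emph{approximately sharp} if $\|\mathsf E(X)\|=1$ for every open $X\subseteq G$ with $\mathsf E(X)\neq 0$. Let $M_1^+(G)$ be the convex set of probability measures on $\mathcal B(G)$ and, for a state $\varrho$ (a positive trace-class operator of trace one on $\mathcal H$), let $\Theta_{\mathsf E}(\varrho)\in M_1^+(G)$ be the measure $X\mapsto\operatorname{tr}(\varrho\,\mathsf E(X))$. For $\mathsf E,\mathsf F\in\mathcal O_U$, say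 that $\mathsf F$ is a \emph{postprocessing} of $\mathsf E$ if $\Theta_{\mathsf F}=\Psi\circ\Theta_{\mathsf E}$ for some affine map $\Psi:M_1^+(G)\to M_1^+(G)$, and that $\mathsf E$ and $\mathsf F$ are \emph{postprocessing equivalent} if each is a postprocessing of the other. Call $\mathsf E\in\mathcal O_U$ \emph{postprocessing clean in $\mathcal O_U$} if every $\mathsf F\in\mathcal O_U$ of which $\mathsf E$ is a postprocessing is postprocessing equivalent to $\mathsf E$. For $x\in G$ the translate $\mathsf E_x$ is the observable $\mathsf E_x(X)=\mathsf E(Xx^{-1})$. \textbf{Proposition.} Let $\mathsf E\in\mathcal O_U$ be approximately sharp. Then $\mathsf E$ is postprocessing clean in $\mathcal O_U$. Moreover, an observable $\mathsf F\in\mathcal O_U$ is postprocessing equivalent to $\mathsf E$ if and only if $\mathsf F=\mathsf E_x$ for some $x\in G$. -/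

import Mathlib

open MeasureTheory Set
open scoped ENNReal NNReal Pointwise InnerProductSpace

noncomputable section

section Trace

theorem hasSum_sq_inner {H : Type*} [NormedAddCommGroup H] [InnerProductSpace ℂ H] {ι : Type*}
    (b : HilbertBasis ι ℂ H) (x : H) :
    HasSum (fun i => ‖⟪x, b i⟫_ℂ‖ ^ 2) (‖x‖ ^ 2) := by
  have h := b.hasSum_inner_mul_inner x x
  have h2 := Complex.hasSum_re h
  rw [inner_self_eq_norm_sq_to_K] at h2
  convert h2 using 1
  · ext i
    rw [← inner_conj_symm x (b i), Complex.conj_mul', ← inner_conj_symm (b i) x]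
    simp only [RCLike.norm_conj]
    norm_cast
  · norm_cast

variable {H : Type*} [NormedAddCommGroup H] [InnerProductSpace ℂ H] [CompleteSpace H]

/-- The index set of a fixed Hilbert (i.e. complete orthonormal) basis of `H`. -/
def stdIndex (H : Type*) [NormedAddCommGroup H] [InnerProductSpace ℂ H] [CompleteSpace H] :
    Set H :=
  (exists_hilbertBasis ℂ H).choose

/-- A fixed Hilbert basis of `H`, used to write down traces. -/
def stdBasis (H : Type*) [NormedAddCommGroup H] [InnerProductSpace ℂ H] [CompleteSpace H] :
    HilbertBasis (stdIndex H) ℂ H :=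
  (exists_hilbertBasis ℂ H).choose_spec.choose

/-- `T` is a trace-class operator: `∑ ⟨e_i, |T| e_i⟩ < ∞`. -/
def IsTraceClass (T : H →L[ℂ] H) : Prop :=
  Summable fun i => ⟪stdBasis H i, CFC.abs T (stdBasis H i)⟫_ℂ

/-- The trace `∑ ⟨e_i, T e_i⟩` of a trace-class operator `T`. -/
def opTrace (T : H →L[ℂ] H) : ℂ :=
  ∑' i, ⟪stdBasis H i, T (stdBasis H i)⟫_ℂ

/-- A state: a positive trace-class operator of trace one. -/
structure QState (H : Type*) [NormedAddCommGroup H] [InnerProductSpace ℂ H] [CompleteSpace H] where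
  op : H →L[ℂ] H
  nonneg : 0 ≤ op
  traceClass : IsTraceClass op
  trace_eq_one : opTrace op = 1

/-- Cyclicity of the trace for a product of two Hilbert-Schmidt operators, computed in two
possibly different Hilbert bases. -/
theorem exists_hasSum_trace {ι κ : Type*} (b : HilbertBasis ι ℂ H) (c : HilbertBasis κ ℂ H)
    (S A : H →L[ℂ] H) (hS : IsSelfAdjoint S) (hb : Summable fun j => ‖S (c j)‖ ^ 2) :
    ∃ t : ℂ, HasSum (fun i => ⟪b i, S (S (A (b i)))⟫_ℂ) t ∧
      HasSum (fun j => ⟪S (c j), A (S (c j))⟫_ℂ) t := by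
  have hsym : ∀ x y, ⟪S x, y⟫_ℂ = ⟪x, S y⟫_ℂ := fun x y => by
    rw [← ContinuousLinearMap.adjoint_inner_right, hS.adjoint_eq]
  have key : ∀ T : H →L[ℂ] H,
      Summable fun p : κ × ι => ‖⟪T (S (c p.1)), b p.2⟫_ℂ‖ ^ 2 := by
    intro T
    rw [summable_prod_of_nonneg (fun _ => by positivity)]
    refine ⟨fun j => (hasSum_sq_inner b (T (S (c j)))).summable, ?_⟩
    simp_rw [fun j => (hasSum_sq_inner b (T (S (c j)))).tsum_eq]
    refine Summable.of_nonneg_of_le (fun _ => by positivity) (fun j => ?_)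
      (hb.mul_left (‖T‖ ^ 2))
    rw [← mul_pow]
    gcongr
    exact T.le_opNorm _
  set T := ContinuousLinearMap.adjoint A with hT
  have hsum : Summable fun p : κ × ι => ⟪T (S (c p.1)), b p.2⟫_ℂ * ⟪b p.2, S (c p.1)⟫_ℂ := by
    refine Summable.of_norm_bounded ((key T).add (key 1)) (fun p => ?_)
    rw [norm_mul, ← inner_conj_symm (b p.2), RCLike.norm_conj]
    simp only [one_apply_eq_self]
    nlinarith [sq_nonneg (‖⟪T (S (c p.1)), b p.2⟫_ℂ‖ - ‖⟪S (c p.1), b p.2⟫_ℂ‖),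
      sq_nonneg (‖⟪T (S (c p.1)), b p.2⟫_ℂ‖), sq_nonneg (‖⟪S (c p.1), b p.2⟫_ℂ‖)]
  refine ⟨∑' p : κ × ι, ⟪T (S (c p.1)), b p.2⟫_ℂ * ⟪b p.2, S (c p.1)⟫_ℂ, ?_, ?_⟩
  rotate_left
  · have := hsum.hasSum.prod_fiberwise
      (fun j => b.hasSum_inner_mul_inner (T (S (c j))) (S (c j)))
    simpa only [hT, ContinuousLinearMap.adjoint_inner_left] using this
  · have h2 := (Equiv.prodComm ι κ).hasSum_iff.mpr hsum.hasSum
    refine h2.prod_fiberwise (fun i => ?_)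
    have h3 := c.hasSum_inner_mul_inner (S (b i)) (S (A (b i)))
    rw [hsym] at h3
    have e : ∀ j, ⟪T (S (c j)), b i⟫_ℂ * ⟪b i, S (c j)⟫_ℂ =
        ⟪S (b i), c j⟫_ℂ * ⟪c j, S (A (b i))⟫_ℂ := fun j => by
      rw [hT, ContinuousLinearMap.adjoint_inner_left, hsym (c j), hsym (b i), mul_comm]
    simp_rw [← e] at h3
    exact h3

theorem QState.summable_sqrt (ρ : QState H) :
    Summable fun i => ‖CFC.sqrt ρ.op (stdBasis H i)‖ ^ 2 := by
  have h := ρ.traceClass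
  rw [IsTraceClass, CFC.abs_of_nonneg _ ρ.nonneg] at h
  have h2 := (Complex.hasSum_re h.hasSum).summable
  have hS : IsSelfAdjoint (CFC.sqrt ρ.op) := IsSelfAdjoint.of_nonneg (CFC.sqrt_nonneg ρ.op)
  refine h2.congr (fun i => ?_)
  conv_lhs => rw [← CFC.sqrt_mul_sqrt_self ρ.op ρ.nonneg]
  rw [mul_apply_eq_comp, ← ContinuousLinearMap.adjoint_inner_left, hS.adjoint_eq,
    inner_self_eq_norm_sq_to_K]
  norm_cast

/-- For a state `ρ`, the trace `tr (ρ A)` may be computed in every Hilbert basis. -/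
theorem QState.hasSum_trace (ρ : QState H) (A : H →L[ℂ] H) {ι : Type*} (b : HilbertBasis ι ℂ H) :
    HasSum (fun i => ⟪b i, (ρ.op * A) (b i)⟫_ℂ) (opTrace (ρ.op * A)) ∧
    HasSum (fun j => ⟪CFC.sqrt ρ.op (stdBasis H j), A (CFC.sqrt ρ.op (stdBasis H j))⟫_ℂ)
      (opTrace (ρ.op * A)) := by
  have hS : IsSelfAdjoint (CFC.sqrt ρ.op) := IsSelfAdjoint.of_nonneg (CFC.sqrt_nonneg ρ.op)
  have hop : ∀ x, (ρ.op * A) x = CFC.sqrt ρ.op (CFC.sqrt ρ.op (A x)) := fun x => by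
    conv_lhs => rw [← CFC.sqrt_mul_sqrt_self ρ.op ρ.nonneg]
    rfl
  obtain ⟨t, h1, h2⟩ := exists_hasSum_trace b (stdBasis H) _ A hS ρ.summable_sqrt
  obtain ⟨s, h3, h4⟩ := exists_hasSum_trace (stdBasis H) (stdBasis H) _ A hS ρ.summable_sqrt
  obtain rfl := h2.unique h4
  have ht : opTrace (ρ.op * A) = t := by
    simp_rw [opTrace, hop]
    exact h3.tsum_eq
  rw [ht]
  simp_rw [hop]
  exact ⟨h1, h2⟩

end Trace

/-- An observable on the Borel (or any) σ-algebra of `Ω`: a normalized positive operator valued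
measure. Only the values on measurable sets matter; as for Mathlib's vector measures, the value on
a non-measurable set is set to `0`, so that equality of observables is equality on all measurable
sets. -/
@[ext]
structure Observable (Ω : Type*) [MeasurableSpace Ω] (H : Type*) [NormedAddCommGroup H]
    [InnerProductSpace ℂ H] [CompleteSpace H] where
  toFun : Set Ω → H →L[ℂ] H
  nonneg' : ∀ X, MeasurableSet X → 0 ≤ toFun X
  le_one' : ∀ X, MeasurableSet X → toFun X ≤ 1
  univ' : toFun univ = 1
  iUnion' : ∀ X : ℕ → Set Ω, (∀ i, MeasurableSet (X i)) → Pairwise (Function.onFun Disjoint X) →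
    HasSum (fun i => ContinuousLinearMapWOT.ofCLM (toFun (X i)))
      (ContinuousLinearMapWOT.ofCLM (toFun (⋃ i, X i)))
  not_measurable' : ∀ X, ¬ MeasurableSet X → toFun X = 0

namespace Observable

variable {Ω : Type*} [MeasurableSpace Ω] {H : Type*} [NormedAddCommGroup H]
  [InnerProductSpace ℂ H] [CompleteSpace H]

instance : CoeFun (Observable Ω H) (fun _ => Set Ω → H →L[ℂ] H) := ⟨toFun⟩

theorem hasSum_inner (E : Observable Ω H) {X : ℕ → Set Ω} (hX : ∀ i, MeasurableSet (X i))
    (hd : Pairwise (Function.onFun Disjoint X)) (v : H) :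
    HasSum (fun i => ⟪v, E (X i) v⟫_ℂ) ⟪v, E (⋃ i, X i) v⟫_ℂ := by
  have h := E.iUnion' X hX hd
  unfold HasSum at h ⊢
  rw [ContinuousLinearMapWOT.tendsto_iff_forall_inner_apply_tendsto] at h
  refine (h v v).congr (fun s => ?_)
  induction s using Finset.cons_induction with
  | empty => simp
  | cons a s ha ih =>
    rw [Finset.sum_cons, Finset.sum_cons, ContinuousLinearMapWOT.add_apply, inner_add_right, ih]
    rfl

theorem inner_eq_ofReal (E : Observable Ω H) {X : Set Ω} (hX : MeasurableSet X) (v : H) :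
    ∃ r : ℝ≥0, ⟪v, E X v⟫_ℂ = (r : ℝ) := by
  have h := ((ContinuousLinearMap.nonneg_iff_isPositive _).1 (E.nonneg' X hX)).inner_nonneg_right v
  obtain ⟨h1, h2⟩ := Complex.nonneg_iff.1 h
  exact ⟨⟨_, h1⟩, Complex.ext rfl h2.symm⟩

theorem exists_hasSum_trace_mul (E : Observable Ω H) (ρ : QState H) {X : Set Ω}
    (hX : MeasurableSet X) :
    ∃ f : stdIndex H → ℝ≥0, ∃ t : ℝ≥0,
      (∀ j, ⟪CFC.sqrt ρ.op (stdBasis H j), E X (CFC.sqrt ρ.op (stdBasis H j))⟫_ℂ = (f j : ℝ)) ∧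
      HasSum f t ∧ opTrace (ρ.op * E X) = (t : ℝ) := by
  choose f hf using fun j => E.inner_eq_ofReal hX (CFC.sqrt ρ.op (stdBasis H j))
  have h := (ρ.hasSum_trace (E X) (stdBasis H)).2
  simp_rw [hf] at h
  have h2 := Complex.hasSum_re h
  simp only [Complex.ofReal_re] at h2
  have h0 : 0 ≤ (opTrace (ρ.op * E X)).re := h2.nonneg (fun j => (f j).2)
  have h3 : HasSum f (opTrace (ρ.op * E X)).re.toNNReal := by
    rw [← NNReal.hasSum_coe, Real.coe_toNNReal _ h0]
    exact h2
  refine ⟨f, _, hf, h3, ?_⟩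
  rw [Real.coe_toNNReal _ h0]
  exact h.unique (Complex.hasSum_ofReal.2 h2)

theorem trace_iUnion (E : Observable Ω H) (ρ : QState H) {X : ℕ → Set Ω}
    (hX : ∀ i, MeasurableSet (X i)) (hd : Pairwise (Function.onFun Disjoint X)) :
    ENNReal.ofReal (opTrace (ρ.op * E (⋃ i, X i))).re =
      ∑' i, ENNReal.ofReal (opTrace (ρ.op * E (X i))).re := by
  choose f t hf hs ht using fun i => E.exists_hasSum_trace_mul ρ (hX i)
  obtain ⟨g, s, hg, hs', hs''⟩ := E.exists_hasSum_trace_mul ρ (MeasurableSet.iUnion hX)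
  simp_rw [ht, hs'', Complex.ofReal_re, ENNReal.ofReal_coe_nnreal]
  have e1 : ∀ i, (t i : ℝ≥0∞) = ∑' j, (f i j : ℝ≥0∞) := fun i => by
    rw [← (hs i).tsum_eq, ENNReal.coe_tsum (hs i).summable]
  have e2 : (s : ℝ≥0∞) = ∑' j, (g j : ℝ≥0∞) := by
    rw [← hs'.tsum_eq, ENNReal.coe_tsum hs'.summable]
  simp_rw [e1, e2]
  rw [ENNReal.tsum_comm]
  refine tsum_congr (fun j => ?_)
  have h := E.hasSum_inner hX hd (CFC.sqrt ρ.op (stdBasis H j))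
  simp_rw [hf, hg] at h
  have h2 := Complex.hasSum_ofReal.1 h
  have h3 := NNReal.hasSum_coe.1 h2
  rw [← h3.tsum_eq, ENNReal.coe_tsum h3.summable]

/-- The measure `X ↦ tr (ρ E(X))`; this trace is a nonnegative real number for measurable `X`. -/
def outcomeMeasure (E : Observable Ω H) (ρ : QState H) : Measure Ω :=
  Measure.ofMeasurable (fun X _ => ENNReal.ofReal (opTrace (ρ.op * E X)).re)
    (by
      have h := E.hasSum_inner (X := fun _ => ∅) (fun _ => MeasurableSet.empty)
        (fun _ _ _ => disjoint_bot_left)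
      have h0 : ∀ v, ⟪v, E ∅ v⟫_ℂ = 0 := fun v =>
        (summable_const_iff _).1 (h v).summable
      obtain ⟨f, t, hf, hs, ht⟩ := E.exists_hasSum_trace_mul ρ MeasurableSet.empty
      simp_rw [h0] at hf
      have : f = 0 := by
        ext j
        have := hf j
        norm_cast at this
        simp [← this]
      subst this
      rw [ht, hs.unique hasSum_zero]
      simp)
    (fun _ hX hd => E.trace_iUnion ρ hX hd)

theorem outcomeMeasure_apply (E : Observable Ω H) (ρ : QState H) {X : Set Ω}
    (hX : MeasurableSet X) :
    E.outcomeMeasure ρ X = ENNReal.ofReal (opTrace (ρ.op * E X)).re :=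
  Measure.ofMeasurable_apply X hX

/-- The map `Θ_E` from states to probability measures: `Θ_E(ρ)` is the probability measure
`X ↦ tr (ρ E(X))` of measurement outcomes. -/
def outcomeDistribution (E : Observable Ω H) (ρ : QState H) : ProbabilityMeasure Ω :=
  ⟨E.outcomeMeasure ρ, ⟨by
    rw [E.outcomeMeasure_apply ρ MeasurableSet.univ, E.univ', mul_one, ρ.trace_eq_one]
    simp⟩⟩

theorem outcomeDistribution_apply (E : Observable Ω H) (ρ : QState H) {X : Set Ω}
    (hX : MeasurableSet X) :
    (((E.outcomeDistribution ρ : Measure Ω).real X : ℝ) : ℂ) = opTrace (ρ.op * E X) := by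
  obtain ⟨f, t, hf, hs, ht⟩ := E.exists_hasSum_trace_mul ρ hX
  change (((E.outcomeMeasure ρ).real X : ℝ) : ℂ) = _
  rw [Measure.real, E.outcomeMeasure_apply ρ hX, ht]
  simp

/-- `E` is approximately sharp: `‖E(X)‖ = 1` for every open set `X` with `E(X) ≠ 0`. -/
def IsApproximatelySharp [TopologicalSpace Ω] (E : Observable Ω H) : Prop :=
  ∀ X : Set Ω, IsOpen X → E X ≠ 0 → ‖E X‖ = 1

end Observable

/-- A map `Ψ` between probability measures is affine if it preserves convex combinations. -/
def IsAffineMap {Ω : Type*} [MeasurableSpace Ω]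
    (Ψ : ProbabilityMeasure Ω → ProbabilityMeasure Ω) : Prop :=
  ∀ (s t : ℝ≥0), s + t = 1 → ∀ p q r : ProbabilityMeasure Ω,
    (r : Measure Ω) = s • (p : Measure Ω) + t • (q : Measure Ω) →
    (Ψ r : Measure Ω) = s • (Ψ p : Measure Ω) + t • (Ψ q : Measure Ω)

namespace Observable

variable {H : Type*} [NormedAddCommGroup H] [InnerProductSpace ℂ H] [CompleteSpace H]

section Post

variable {Ω : Type*} [MeasurableSpace Ω]

/-- `F` is a postprocessing of `E`: there is an affine map `Ψ` of probability measures with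
`Θ_F = Ψ ∘ Θ_E`. -/
def IsPostprocessingOf (F E : Observable Ω H) : Prop :=
  ∃ Ψ : ProbabilityMeasure Ω → ProbabilityMeasure Ω,
    IsAffineMap Ψ ∧ F.outcomeDistribution = Ψ ∘ E.outcomeDistribution

/-- Postprocessing equivalence. -/
def PostprocessingEquiv (E F : Observable Ω H) : Prop :=
  F.IsPostprocessingOf E ∧ E.IsPostprocessingOf F

end Post

variable {G : Type*} [Group G]

theorem image_mul_right_inv (x : G) (X : Set G) :
    (fun h => h * x⁻¹) '' X = (fun h => h * x) ⁻¹' X := by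
  simp [Set.image_mul_right]

variable [MeasurableSpace G]

/-- The set of `U`-covariant observables: `U(g) E(X) U(g)* = E(gX)`. -/
def covariant (U : G →* unitary (H →L[ℂ] H)) : Set (Observable G H) :=
  {E | ∀ (g : G) (X : Set G), MeasurableSet X →
    (U g : H →L[ℂ] H) * E X * star (U g : H →L[ℂ] H) = E (g • X)}

/-- `E` is postprocessing clean in the set of `U`-covariant observables. -/
def IsPostprocessingClean (U : G →* unitary (H →L[ℂ] H)) (E : Observable G H) : Prop :=
  ∀ F ∈ covariant U, E.IsPostprocessingOf F → PostprocessingEquiv E F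

variable [MeasurableMul G]

/-- The translate `E_x` of `E`, given by `E_x(X) = E(X x⁻¹)`. -/
def translate (E : Observable G H) (x : G) : Observable G H where
  toFun X := E ((fun h => h * x⁻¹) '' X)
  nonneg' X hX := by
    rw [image_mul_right_inv]
    exact E.nonneg' _ (measurable_mul_const x hX)
  le_one' X hX := by
    rw [image_mul_right_inv]
    exact E.le_one' _ (measurable_mul_const x hX)
  univ' := by
    rw [image_mul_right_inv, Set.preimage_univ]
    exact E.univ'
  iUnion' X hX hd := by
    simp_rw [image_mul_right_inv, Set.preimage_iUnion]
    exact E.iUnion' _ (fun i => measurable_mul_const x (hX i))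
      (fun i j hij => (hd hij).preimage _)
  not_measurable' X hX := by
    refine E.not_measurable' _ (fun h => hX ?_)
    have h2 := measurable_mul_const x⁻¹ h
    rw [image_mul_right_inv, ← Set.preimage_comp] at h2
    simpa [Function.comp_def] using h2

end Observable

end

/-! The core is a rigidity statement, `Observable.eq_translate_of_isPostprocessingOf`: if the
approximately sharp `E` is a postprocessing of a covariant `F` through an affine `Ψ`, then `E` is a
right translate of `F`. Since translates are postprocessings of each other, cleanness and the
description of the equivalence class both follow.

Nothing is assumed about continuity or equivariance of `Ψ`. Continuity is automatic: extended to the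
cone of finite measures, `Ψ` is additive and mass preserving, hence Lipschitz in total variation.
Equivariance is forced by averaging: with `λ` the Haar probability measure, `(q, f) ↦ ∫ f dΨ(qλ)` is
a bounded bilinear form on continuous functions, and its average over left translations is
invariant. An approximate identity turns an invariant positive form into a single positive
functional, that is, into a probability measure `ν`, and the averaged map is `P ↦ P ∗ ν`
(`IsAffineMap.exists_eq_mconv`). Averaging changes nothing on the outcome distributions `P` of `F`
in pure states, because covariance of both observables makes `Ψ` commute with translations of `P`.
Strong continuity of `U` puts such `P` in the total variation closure of the continuous densities.
So `Θ_E = Θ_F ∗ ν` on pure states.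

Sharpness now makes `ν` a point mass. For a neighbourhood `V` of `1`, covariance and compactness
give `E V ≠ 0`, so `‖E V‖ = 1` and some pure state gives `V` probability close to `1`. This
probability is an average of the numbers `ν (g⁻¹ V)`, so `ν` is almost concentrated on a translate
of `V`. As `V` shrinks, the support of `ν` can contain only one point `x`
(`exists_eq_dirac_of_concentrated`), and convolution with `δ_x` is translation by `x`. -/

open Filter Topology

/-! ### Jordan decomposition of a difference of finite measures. -/

section TotalVariation

variable {Ω : Type*} [MeasurableSpace Ω]

/-- Subtraction of measures is truncated, so the two differences are the positive and negative parts
of the signed measure `μ - ν`. -/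
theorem MeasureTheory.Measure.add_sub_eq_add_sub (μ ν : Measure Ω) [IsFiniteMeasure μ]
    [IsFiniteMeasure ν] : μ + (ν - μ) = ν + (μ - ν) := by
  have h := Measure.sub_toSignedMeasure_eq_toSignedMeasure_sub (μ := μ) (ν := ν)
  rw [sub_eq_sub_iff_add_eq_add, ← Measure.toSignedMeasure_add, ← Measure.toSignedMeasure_add] at h
  rw [Measure.toSignedMeasure_eq_toSignedMeasure_iff.1 h, add_comm]

/-- All the mass of `μ - ν` sits on one half of a Hahn decomposition, and there it is the actual
difference of the two values. -/
theorem MeasureTheory.Measure.sub_real_univ_le {μ ν : Measure Ω} [IsFiniteMeasure μ]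
    [IsFiniteMeasure ν] {t : ℝ} (h : ∀ X, MeasurableSet X → |μ.real X - ν.real X| ≤ t) :
    (μ - ν).real univ ≤ t := by
  obtain ⟨s, hs⟩ := exists_isHahnDecomposition μ ν
  have h1 : (μ - ν) s = 0 := Measure.sub_apply_eq_zero_of_isHahnDecomposition hs
  have h2 : (ν - μ) sᶜ = 0 := Measure.sub_apply_eq_zero_of_isHahnDecomposition hs.compl
  have h3 := congrArg (fun m : Measure Ω => m.real sᶜ) (Measure.add_sub_eq_add_sub μ ν)
  beta_reduce at h3
  rw [measureReal_add_apply, measureReal_add_apply, measureReal_def (ν - μ), h2] at h3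
  have h4 := measureReal_add_measureReal_compl (μ := μ - ν) hs.measurableSet
  rw [measureReal_def (μ - ν) s, h1] at h4
  have h5 := (abs_le.1 (h _ hs.measurableSet.compl)).2
  simp only [ENNReal.toReal_zero] at h3 h4
  linarith

end TotalVariation

/-! ### Affine maps extended to finite measures. -/

section ConeExtension

variable {Ω : Type*} [MeasurableSpace Ω] [Nonempty Ω]

/-- The positively homogeneous extension of a self-map of the probability measures to the finite
measures. -/
noncomputable def coneExtension (Ψ : ProbabilityMeasure Ω → ProbabilityMeasure Ω)
    (m : FiniteMeasure Ω) : FiniteMeasure Ω :=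
  -- For `m = 0` the normalization is a default probability measure, which the factor `m.mass = 0`
  -- removes.
  m.mass • (Ψ m.normalize).toFiniteMeasure

variable {Ψ : ProbabilityMeasure Ω → ProbabilityMeasure Ω}

theorem coneExtension_coe (p : ProbabilityMeasure Ω) :
    coneExtension Ψ p.toFiniteMeasure = (Ψ p).toFiniteMeasure := by
  simp [coneExtension]

theorem mass_coneExtension (m : FiniteMeasure Ω) : (coneExtension Ψ m).mass = m.mass := by
  have : (Ψ m.normalize).toFiniteMeasure.mass = 1 := ProbabilityMeasure.mass_toFiniteMeasure _
  rw [FiniteMeasure.mass] at this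
  rw [coneExtension, FiniteMeasure.mass, FiniteMeasure.smul_apply, this]
  simp

theorem coneExtension_smul (c : ℝ≥0) (m : FiniteMeasure Ω) :
    coneExtension Ψ (c • m) = c • coneExtension Ψ m := by
  rcases eq_or_ne m 0 with rfl | hm
  · simp [coneExtension]
  rcases eq_or_ne c 0 with rfl | hc
  · simp [coneExtension]
  have hmass : (c • m).mass = c * m.mass := by
    rw [FiniteMeasure.mass, FiniteMeasure.smul_apply]; rfl
  have hm' := m.mass_nonzero_iff.2 hm
  have hcm : c • m ≠ 0 := by
    rw [← FiniteMeasure.mass_nonzero_iff, hmass]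
    exact mul_ne_zero hc hm'
  have hn : (c • m).normalize = m.normalize := by
    apply ProbabilityMeasure.eq_of_forall_apply_eq
    intro s _
    rw [FiniteMeasure.normalize_eq_of_nonzero _ hcm, FiniteMeasure.normalize_eq_of_nonzero _ hm,
      hmass, FiniteMeasure.smul_apply, smul_eq_mul]
    field_simp
  rw [coneExtension, coneExtension, hn, hmass, mul_smul]

theorem IsAffineMap.coneExtension_add (hΨ : IsAffineMap Ψ) (m m' : FiniteMeasure Ω) :
    coneExtension Ψ (m + m') = coneExtension Ψ m + coneExtension Ψ m' := by
  have hMadd : (m + m').mass = m.mass + m'.mass := by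
    rw [FiniteMeasure.mass, FiniteMeasure.coeFn_add]
    rfl
  rcases eq_or_ne (m + m') 0 with h | h
  · have h2 := hMadd.symm.trans ((m + m').mass_zero_iff.2 h)
    have h3 : m = 0 := m.mass_zero_iff.1 (add_eq_zero.1 h2).1
    have h4 : m' = 0 := m'.mass_zero_iff.1 (add_eq_zero.1 h2).2
    subst h3 h4
    simp [coneExtension]
  set M := (m + m').mass with hM
  have hM0 : M ≠ 0 := (m + m').mass_nonzero_iff.2 h
  -- The normalization of `m + m'` is the convex combination of the two normalizations, weighted by
  -- their shares of the total mass `M`.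
  have key := hΨ (M⁻¹ * m.mass) (M⁻¹ * m'.mass)
    (by rw [← mul_add, ← hMadd, inv_mul_cancel₀ hM0]) m.normalize m'.normalize
    (m + m').normalize (by
      rw [FiniteMeasure.toMeasure_normalize_eq_of_nonzero _ h, mul_smul, mul_smul, ← smul_add]
      congr 1
      rw [FiniteMeasure.toMeasure_add]
      congr 1
      · conv_lhs => rw [m.self_eq_mass_smul_normalize]
        rfl
      · conv_lhs => rw [m'.self_eq_mass_smul_normalize]
        rfl)
  apply Subtype.ext
  change M • (Ψ (m + m').normalize : Measure Ω) =
    m.mass • (Ψ m.normalize : Measure Ω) + m'.mass • (Ψ m'.normalize : Measure Ω)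
  rw [key, smul_add, smul_smul, smul_smul, mul_inv_cancel_left₀ hM0, mul_inv_cancel_left₀ hM0]

end ConeExtension

/-! ### Linear extension from the cone of nonnegative functions. -/

section Cone

variable {X : Type*} [TopologicalSpace X] [CompactSpace X]

/-- An additive, positively homogeneous, bounded map on the cone of nonnegative continuous
functions extends to a bounded linear map. -/
theorem ContinuousMap.exists_linearMap_of_nonneg {V : Type*} [NormedAddCommGroup V]
    [NormedSpace ℝ V] (N : C(X, ℝ) → V) (hadd : ∀ p q, 0 ≤ p → 0 ≤ q → N (p + q) = N p + N q)
    (hsmul : ∀ (c : ℝ≥0) p, 0 ≤ p → N ((c : ℝ) • p) = (c : ℝ) • N p)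
    (hbound : ∀ p, 0 ≤ p → ‖N p‖ ≤ ‖p‖) :
    ∃ T : C(X, ℝ) →ₗ[ℝ] V, (∀ p, ‖T p‖ ≤ 2 * ‖p‖) ∧ ∀ p, 0 ≤ p → T p = N p := by
  -- The difference `N p - N q` depends on `p - q` alone, so any decomposition into nonnegative
  -- functions may be used to check linearity.
  have hsub : ∀ p q p' q' : C(X, ℝ), 0 ≤ p → 0 ≤ q → 0 ≤ p' → 0 ≤ q' → p - q = p' - q' →
      N p - N q = N p' - N q' := by
    intro p q p' q' hp hq hp' hq' h
    rw [sub_eq_sub_iff_add_eq_add] at h ⊢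
    rw [← hadd _ _ hp hq', ← hadd _ _ hp' hq, h]
  have h0 : N 0 = 0 := by simpa using hsmul 0 0 le_rfl
  have hpos : ∀ p : C(X, ℝ), ‖p⁺‖ ≤ ‖p‖ := fun p => by
    refine (ContinuousMap.norm_le _ (norm_nonneg _)).2 (fun x => ?_)
    have h1 := p.norm_coe_le_norm x
    have h2 : p⁺ x = max (p x) 0 := rfl
    rw [h2]
    exact le_trans (by rw [Real.norm_eq_abs, Real.norm_eq_abs,
      abs_of_nonneg (le_max_right _ _)]; exact max_le (le_abs_self _) (abs_nonneg _)) h1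
  have hneg : ∀ p : C(X, ℝ), ‖p⁻‖ ≤ ‖p‖ := fun p => by
    have := hpos (-p)
    rwa [posPart_neg, norm_neg] at this
  let T : C(X, ℝ) →ₗ[ℝ] V :=
    { toFun := fun q => N q⁺ - N q⁻
      map_add' := fun p q => by
        have : N p⁺ - N p⁻ + (N q⁺ - N q⁻) = N (p⁺ + q⁺) - N (p⁻ + q⁻) := by
          rw [hadd _ _ (posPart_nonneg _) (posPart_nonneg _),
            hadd _ _ (negPart_nonneg _) (negPart_nonneg _)]
          abel
        rw [this]
        refine hsub _ _ _ _ (posPart_nonneg _) (negPart_nonneg _)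
          (add_nonneg (posPart_nonneg _) (posPart_nonneg _))
          (add_nonneg (negPart_nonneg _) (negPart_nonneg _)) ?_
        rw [posPart_sub_negPart, add_sub_add_comm, posPart_sub_negPart, posPart_sub_negPart]
      map_smul' := fun c q => by
        rcases le_total 0 c with hc | hc
        · lift c to ℝ≥0 using hc
          rw [RingHom.id_apply, smul_sub, ← hsmul c _ (posPart_nonneg _),
            ← hsmul c _ (negPart_nonneg _)]
          refine hsub _ _ _ _ (posPart_nonneg _) (negPart_nonneg _)
            (smul_nonneg c.2 (posPart_nonneg _)) (smul_nonneg c.2 (negPart_nonneg _)) ?_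
          rw [posPart_sub_negPart, ← smul_sub, posPart_sub_negPart]
        · obtain ⟨d, rfl⟩ : ∃ d, c = -d := ⟨-c, by simp⟩
          have hd : 0 ≤ d := by linarith
          lift d to ℝ≥0 using hd
          have : -(d : ℝ) • (N q⁺ - N q⁻) = (d : ℝ) • N q⁻ - (d : ℝ) • N q⁺ := by module
          rw [RingHom.id_apply, this, ← hsmul d _ (posPart_nonneg _),
            ← hsmul d _ (negPart_nonneg _)]
          refine hsub _ _ _ _ (posPart_nonneg _) (negPart_nonneg _)
            (smul_nonneg d.2 (negPart_nonneg _)) (smul_nonneg d.2 (posPart_nonneg _)) ?_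
          rw [posPart_sub_negPart, ← smul_sub, ← neg_sub, posPart_sub_negPart]
          module }
  refine ⟨T, fun p => ?_, fun p hp => ?_⟩
  · calc ‖N p⁺ - N p⁻‖ ≤ ‖N p⁺‖ + ‖N p⁻‖ := norm_sub_le _ _
      _ ≤ ‖p‖ + ‖p‖ := add_le_add ((hbound _ (posPart_nonneg _)).trans (hpos p))
          ((hbound _ (negPart_nonneg _)).trans (hneg p))
      _ = 2 * ‖p‖ := by ring
  · change N p⁺ - N p⁻ = N p
    rw [posPart_of_nonneg hp, negPart_of_nonneg hp, h0, sub_zero]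

end Cone

/-! ### Finite measures as functionals, and measures with continuous density. -/

section IntegralCLM

variable {X : Type*} [TopologicalSpace X] [CompactSpace X] [MeasurableSpace X] [BorelSpace X]

theorem ContinuousMap.integrable_of_isFiniteMeasure (f : C(X, ℝ)) (μ : Measure X)
    [IsFiniteMeasure μ] : Integrable f μ :=
  (BoundedContinuousFunction.mkOfCompact f).integrable μ

theorem ContinuousMap.abs_integral_le (f : C(X, ℝ)) (μ : Measure X) [IsFiniteMeasure μ] :
    |∫ x, f x ∂μ| ≤ μ.real univ * ‖f‖ := by
  simpa using (BoundedContinuousFunction.mkOfCompact f).norm_integral_le_mul_norm μ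

/-- Integration against a finite measure, as a continuous functional. -/
noncomputable def MeasureTheory.FiniteMeasure.integralCLM (μ : FiniteMeasure X) : C(X, ℝ) →L[ℝ] ℝ :=
  LinearMap.mkContinuous
    { toFun := fun f => ∫ x, f x ∂(μ : Measure X)
      map_add' := fun f g => by
        simpa using integral_add (f.integrable_of_isFiniteMeasure _)
          (g.integrable_of_isFiniteMeasure _)
      map_smul' := fun c f => by simp [integral_const_mul] }
    ((μ : Measure X).real univ) (fun f => f.abs_integral_le _)

theorem MeasureTheory.FiniteMeasure.integralCLM_apply (μ : FiniteMeasure X) (f : C(X, ℝ)) :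
    FiniteMeasure.integralCLM μ f = ∫ x, f x ∂(μ : Measure X) := rfl

theorem MeasureTheory.FiniteMeasure.norm_integralCLM_le (μ : FiniteMeasure X) :
    ‖FiniteMeasure.integralCLM μ‖ ≤ μ.mass :=
  LinearMap.mkContinuous_norm_le _ measureReal_nonneg _

theorem MeasureTheory.FiniteMeasure.integralCLM_add (μ ν : FiniteMeasure X) :
    FiniteMeasure.integralCLM (μ + ν) =
      FiniteMeasure.integralCLM μ + FiniteMeasure.integralCLM ν := by
  ext f
  rw [add_apply]
  simp only [FiniteMeasure.integralCLM_apply, FiniteMeasure.toMeasure_add]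
  exact integral_add_measure (f.integrable_of_isFiniteMeasure _) (f.integrable_of_isFiniteMeasure _)

theorem MeasureTheory.FiniteMeasure.integralCLM_smul (c : ℝ≥0) (μ : FiniteMeasure X) :
    FiniteMeasure.integralCLM (c • μ) = (c : ℝ) • FiniteMeasure.integralCLM μ := by
  ext f
  rw [_root_.smul_apply]
  simp only [FiniteMeasure.integralCLM_apply, FiniteMeasure.toMeasure_smul]
  rw [integral_smul_nnreal_measure]
  rfl

/-- The finite measure with continuous density `q⁺` with respect to `μ`. -/
noncomputable def MeasureTheory.FiniteMeasure.ofDensity (μ : Measure X) [IsFiniteMeasure μ]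
    (q : C(X, ℝ)) : FiniteMeasure X :=
  ⟨μ.withDensity fun x => ENNReal.ofReal (q x),
    isFiniteMeasure_withDensity_ofReal (q.integrable_of_isFiniteMeasure μ).2⟩

theorem MeasureTheory.FiniteMeasure.ofDensity_apply (μ : Measure X) [IsFiniteMeasure μ]
    (q : C(X, ℝ)) :
    (FiniteMeasure.ofDensity μ q : Measure X) = μ.withDensity fun x => ENNReal.ofReal (q x) := rfl

theorem MeasureTheory.FiniteMeasure.real_ofDensity (μ : Measure X) [IsFiniteMeasure μ]
    {q : C(X, ℝ)} (hq : 0 ≤ q) {A : Set X} (hA : MeasurableSet A) :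
    (FiniteMeasure.ofDensity μ q : Measure X).real A = ∫ x in A, q x ∂μ := by
  have hq' : ∀ x, 0 ≤ q x := hq
  rw [integral_eq_lintegral_of_nonneg_ae (Eventually.of_forall hq')
    q.continuous.aestronglyMeasurable, measureReal_def, FiniteMeasure.ofDensity_apply,
    withDensity_apply _ hA]

theorem MeasureTheory.FiniteMeasure.integral_ofDensity (μ : Measure X) [IsFiniteMeasure μ]
    {q : C(X, ℝ)} (hq : 0 ≤ q) (f : C(X, ℝ)) :
    ∫ x, f x ∂(FiniteMeasure.ofDensity μ q : Measure X) = ∫ x, q x * f x ∂μ := by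
  have hq' : ∀ x, 0 ≤ q x := hq
  rw [FiniteMeasure.ofDensity_apply, integral_withDensity_eq_integral_toReal_smul
    (by fun_prop) (by simp)]
  exact integral_congr_ae (Eventually.of_forall fun x => by
    beta_reduce
    rw [ENNReal.toReal_ofReal (hq' x), smul_eq_mul])

theorem MeasureTheory.FiniteMeasure.ofDensity_add (μ : Measure X) [IsFiniteMeasure μ]
    {p q : C(X, ℝ)} (hp : 0 ≤ p) (hq : 0 ≤ q) :
    FiniteMeasure.ofDensity μ (p + q) =
      FiniteMeasure.ofDensity μ p + FiniteMeasure.ofDensity μ q := by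
  apply Subtype.ext
  change _ = (FiniteMeasure.ofDensity μ p : Measure X) + (FiniteMeasure.ofDensity μ q : Measure X)
  change μ.withDensity _ = μ.withDensity _ + μ.withDensity _
  rw [← withDensity_add_left (by fun_prop)]
  congr 1
  ext x
  exact ENNReal.ofReal_add (hp x) (hq x)

theorem MeasureTheory.FiniteMeasure.ofDensity_smul (μ : Measure X) [IsFiniteMeasure μ] (c : ℝ≥0)
    (p : C(X, ℝ)) :
    FiniteMeasure.ofDensity μ ((c : ℝ) • p) = c • FiniteMeasure.ofDensity μ p := by
  apply Subtype.ext
  change μ.withDensity _ = c • μ.withDensity _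
  change _ = (c : ℝ≥0∞) • μ.withDensity _
  rw [← withDensity_smul _ (by fun_prop)]
  congr 1
  ext x
  simp [ENNReal.ofReal_mul]

theorem MeasureTheory.FiniteMeasure.mass_ofDensity_le (μ : Measure X) [IsProbabilityMeasure μ]
    {p : C(X, ℝ)} (hp : 0 ≤ p) : (FiniteMeasure.ofDensity μ p).mass ≤ ‖p‖ := by
  have h := FiniteMeasure.real_ofDensity μ hp MeasurableSet.univ
  rw [Measure.restrict_univ] at h
  have h2 := (le_abs_self _).trans (p.abs_integral_le μ)
  rw [probReal_univ (μ := μ), one_mul, ← h] at h2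
  exact h2

end IntegralCLM

/-! ### Automatic total variation continuity of affine maps. -/

section Lipschitz

variable {X : Type*} [TopologicalSpace X] [CompactSpace X] [MeasurableSpace X] [BorelSpace X]
  [Nonempty X] {Ψ : ProbabilityMeasure X → ProbabilityMeasure X}

/-- The cone extension of an affine map is Lipschitz for the total variation distance. -/
theorem IsAffineMap.abs_integral_coneExtension_sub_le (hΨ : IsAffineMap Ψ) (m m' : FiniteMeasure X)
    {t : ℝ} (h : ∀ A, MeasurableSet A → |(m : Measure X).real A - (m' : Measure X).real A| ≤ t)
    (f : C(X, ℝ)) :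
    |∫ x, f x ∂(coneExtension Ψ m : Measure X) - ∫ x, f x ∂(coneExtension Ψ m' : Measure X)| ≤
      2 * t * ‖f‖ := by
  -- Both measures are completed to the same measure by `a` and `b`, each of mass at most `t`.
  -- Additivity and preservation of mass then bound the difference of the images, whence the factor
  -- `2`.
  let a : FiniteMeasure X := ⟨(m : Measure X) - m', isFiniteMeasure_of_le _ Measure.sub_le⟩
  let b : FiniteMeasure X := ⟨(m' : Measure X) - m, isFiniteMeasure_of_le _ Measure.sub_le⟩
  have hab : m + b = m' + a := Subtype.ext (Measure.add_sub_eq_add_sub (m : Measure X) m')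
  have ha : (a.mass : ℝ) ≤ t := Measure.sub_real_univ_le h
  have hb : (b.mass : ℝ) ≤ t := Measure.sub_real_univ_le fun A hA => by
    rw [abs_sub_comm]
    exact h A hA
  have key := congrArg (fun μ => FiniteMeasure.integralCLM (coneExtension Ψ μ) f) hab
  simp only [hΨ.coneExtension_add, FiniteMeasure.integralCLM_add, add_apply] at key
  have h1 : |FiniteMeasure.integralCLM (coneExtension Ψ a) f| ≤ t * ‖f‖ :=
    (ContinuousLinearMap.le_of_opNorm_le _ (FiniteMeasure.norm_integralCLM_le _) f).trans (by
      rw [mass_coneExtension]; gcongr)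
  have h2 : |FiniteMeasure.integralCLM (coneExtension Ψ b) f| ≤ t * ‖f‖ :=
    (ContinuousLinearMap.le_of_opNorm_le _ (FiniteMeasure.norm_integralCLM_le _) f).trans (by
      rw [mass_coneExtension]; gcongr)
  change |FiniteMeasure.integralCLM _ f - FiniteMeasure.integralCLM _ f| ≤ _
  rw [abs_le] at *
  constructor <;> linarith

theorem MeasureTheory.FiniteMeasure.abs_integral_sub_le (m m' : FiniteMeasure X) {t : ℝ}
    (h : ∀ A, MeasurableSet A → |(m : Measure X).real A - (m' : Measure X).real A| ≤ t)
    (f : C(X, ℝ)) :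
    |∫ x, f x ∂(m : Measure X) - ∫ x, f x ∂(m' : Measure X)| ≤ 2 * t * ‖f‖ := by
  have hid : IsAffineMap (id : ProbabilityMeasure X → ProbabilityMeasure X) :=
    fun _ _ _ _ _ _ h => h
  have := hid.abs_integral_coneExtension_sub_le m m' h f
  simpa only [coneExtension, id, ← FiniteMeasure.self_eq_mass_smul_normalize] using this

/-- `ofDensity` truncates negative values, so the cone extension is additive in `q` only for `q ≥
0`. The form is therefore defined on the cone, bounded there because mass is preserved, and then
extended linearly. -/
theorem IsAffineMap.exists_bilin (hΨ : IsAffineMap Ψ) (μ : Measure X) [IsProbabilityMeasure μ] :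
    ∃ B : C(X, ℝ) → C(X, ℝ) → ℝ,
      IsBoundedBilinearMap ℝ (fun p : C(X, ℝ) × C(X, ℝ) => B p.1 p.2) ∧
      ∀ q, 0 ≤ q → ∀ f : C(X, ℝ),
        B q f = ∫ x, f x ∂(coneExtension Ψ (FiniteMeasure.ofDensity μ q) : Measure X) := by
  obtain ⟨B, hbound, hB⟩ := ContinuousMap.exists_linearMap_of_nonneg
    (fun q => FiniteMeasure.integralCLM (coneExtension Ψ (FiniteMeasure.ofDensity μ q)))
    (fun p q hp hq => by
      rw [FiniteMeasure.ofDensity_add μ hp hq, hΨ.coneExtension_add,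
        FiniteMeasure.integralCLM_add])
    (fun c p _ => by
      rw [FiniteMeasure.ofDensity_smul, coneExtension_smul, FiniteMeasure.integralCLM_smul])
    (fun p hp => (FiniteMeasure.norm_integralCLM_le _).trans (by
      rw [mass_coneExtension]
      exact FiniteMeasure.mass_ofDensity_le μ hp))
  refine ⟨fun q f => B q f, ⟨fun p q f => by simp, fun c q f => by simp, fun q f g => by simp,
    fun c q f => by simp, 2, two_pos, fun q f => ?_⟩,
    fun q hq f => by
      beta_reduce
      rw [hB q hq, FiniteMeasure.integralCLM_apply]⟩
  exact ContinuousLinearMap.le_of_opNorm_le _ (hbound q) f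

end Lipschitz

/-! ### Left translation of continuous functions. -/

section LeftTranslation

variable {G : Type*} [Group G] [TopologicalSpace G] [IsTopologicalGroup G]

/-- Left translation of a continuous function: `x ↦ f (g⁻¹ x)`. -/
noncomputable def ContinuousMap.leftTranslate (g : G) (f : C(G, ℝ)) : C(G, ℝ) :=
  f.comp (ContinuousMap.mulLeft g⁻¹)

namespace ContinuousMap

@[simp]
theorem leftTranslate_apply (g : G) (f : C(G, ℝ)) (x : G) :
    leftTranslate g f x = f (g⁻¹ * x) := rfl

theorem leftTranslate_mul (g h : G) (f : C(G, ℝ)) :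
    leftTranslate (g * h) f = leftTranslate g (leftTranslate h f) := by
  ext x
  simp [mul_assoc]

theorem leftTranslate_nonneg (g : G) {f : C(G, ℝ)} (hf : 0 ≤ f) : 0 ≤ leftTranslate g f :=
  fun x => hf (g⁻¹ * x)

variable [CompactSpace G]

theorem norm_leftTranslate_le (g : G) (f : C(G, ℝ)) : ‖leftTranslate g f‖ ≤ ‖f‖ :=
  (norm_le _ (norm_nonneg _)).2 fun _ => f.norm_coe_le_norm _

omit [CompactSpace G] in
theorem continuous_leftTranslate (f : C(G, ℝ)) : Continuous fun g => leftTranslate g f := by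
  refine continuous_of_continuous_uncurry _ ?_
  change Continuous fun p : G × G => f (p.1⁻¹ * p.2)
  fun_prop

end ContinuousMap

end LeftTranslation

/-! ### Averaging a bilinear form over the group. -/

section Averaging

open ContinuousMap

variable {G : Type*} [Group G] [TopologicalSpace G] [IsTopologicalGroup G]
    [CompactSpace G] [T2Space G] [SecondCountableTopology G] [MeasurableSpace G] [BorelSpace G]

theorem Continuous.integrable_of_compactSpace {V : Type*} [NormedAddCommGroup V] {f : G → V}
    (hf : Continuous f) (μ : Measure G) [IsFiniteMeasure μ] : Integrable f μ :=
  hf.integrable_of_hasCompactSupport (HasCompactSupport.of_compactSpace f)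

variable (lam : Measure G) [IsProbabilityMeasure lam] [lam.IsMulLeftInvariant]

omit [T2Space G] [SecondCountableTopology G] in
theorem map_mul_left_ofDensity (g : G) (q : C(G, ℝ)) :
    (FiniteMeasure.ofDensity lam q : Measure G).map (g * ·) =
      FiniteMeasure.ofDensity lam (leftTranslate g q) := by
  ext A hA
  rw [Measure.map_apply (measurable_const_mul g) hA, FiniteMeasure.ofDensity_apply,
    FiniteMeasure.ofDensity_apply, withDensity_apply _ hA,
    withDensity_apply _ (measurable_const_mul g hA),
    ← (measurePreserving_mul_left lam g).setLIntegral_comp_preimage hA (by fun_prop)]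
  simp

omit [T2Space G] [SecondCountableTopology G] [MeasurableSpace G] [BorelSpace G] in
theorem IsBoundedBilinearMap.continuous_leftTranslate {B : C(G, ℝ) → C(G, ℝ) → ℝ}
    (hB : IsBoundedBilinearMap ℝ (fun p : C(G, ℝ) × C(G, ℝ) => B p.1 p.2)) (q f : C(G, ℝ)) :
    Continuous fun h => B (leftTranslate h q) (leftTranslate h f) :=
  hB.continuous.comp
    ((ContinuousMap.continuous_leftTranslate q).prodMk (ContinuousMap.continuous_leftTranslate f))

/-- The average over the group of the left translates of a bilinear form. -/
noncomputable def averageBilin (B : C(G, ℝ) → C(G, ℝ) → ℝ) (q f : C(G, ℝ)) : ℝ :=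
  ∫ h, B (leftTranslate h q) (leftTranslate h f) ∂lam

omit [lam.IsMulLeftInvariant] in
theorem IsBoundedBilinearMap.averageBilin {B : C(G, ℝ) → C(G, ℝ) → ℝ}
    (hB : IsBoundedBilinearMap ℝ (fun p : C(G, ℝ) × C(G, ℝ) => B p.1 p.2)) :
    IsBoundedBilinearMap ℝ (fun p : C(G, ℝ) × C(G, ℝ) => averageBilin lam B p.1 p.2) := by
  have hint := fun q f => (hB.continuous_leftTranslate q f).integrable_of_compactSpace lam
  obtain ⟨C, hC, hbound⟩ := hB.bound
  refine ⟨fun p q f => ?_, fun c q f => ?_, fun q f g => ?_, fun c q f => ?_, C, hC,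
    fun q f => ?_⟩
  · exact (integral_congr_ae (Eventually.of_forall fun h => hB.add_left _ _ _)).trans
      (integral_add (hint _ _) (hint _ _))
  · exact (integral_congr_ae (Eventually.of_forall fun h =>
      hB.smul_left c (leftTranslate h q) (leftTranslate h f))).trans (integral_const_mul _ _)
  · exact (integral_congr_ae (Eventually.of_forall fun h => hB.add_right _ _ _)).trans
      (integral_add (hint _ _) (hint _ _))
  · exact (integral_congr_ae (Eventually.of_forall fun h =>
      hB.smul_right c (leftTranslate h q) (leftTranslate h f))).trans (integral_const_mul _ _)
  · have := norm_integral_le_of_norm_le_const (μ := lam) (C := C * ‖q‖ * ‖f‖)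
      (f := fun h => B (leftTranslate h q) (leftTranslate h f))
      (Eventually.of_forall fun h => by
        refine (hbound _ _).trans ?_
        gcongr <;> exact norm_leftTranslate_le _ _)
    rwa [probReal_univ, mul_one] at this

-- Substitute `h ↦ h * g` in the average; this is where right invariance of Haar measure enters.
omit [CompactSpace G] [T2Space G] [SecondCountableTopology G] [IsProbabilityMeasure lam]
  [lam.IsMulLeftInvariant] in
theorem averageBilin_leftTranslate [lam.IsMulRightInvariant]
    (B : C(G, ℝ) → C(G, ℝ) → ℝ) (g : G) (q f : C(G, ℝ)) :
    averageBilin lam B (leftTranslate g q) f = averageBilin lam B q (leftTranslate g⁻¹ f) := by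
  rw [averageBilin, averageBilin, ← integral_mul_right_eq_self (μ := lam)
    (fun h => B (leftTranslate h q) (leftTranslate h (leftTranslate g⁻¹ f))) g]
  congr 1 with h
  simp [← leftTranslate_mul]

/-- The averaged form keeps positivity and normalization and becomes invariant. The last clause says
that it still computes `Ψ P`, up to the approximation error, when `Ψ` is equivariant along the orbit
of `P`; no equivariance is needed elsewhere. -/
theorem IsAffineMap.exists_invariant_bilin [lam.IsMulRightInvariant]
    {Ψ : ProbabilityMeasure G → ProbabilityMeasure G} (hΨ : IsAffineMap Ψ) :
    ∃ S : C(G, ℝ) → C(G, ℝ) → ℝ,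
      IsBoundedBilinearMap ℝ (fun p : C(G, ℝ) × C(G, ℝ) => S p.1 p.2) ∧
      (∀ g q f, S (leftTranslate g q) f = S q (leftTranslate g⁻¹ f)) ∧
      (∀ q f, 0 ≤ q → 0 ≤ f → 0 ≤ S q f) ∧
      (∀ q, 0 ≤ q → S q 1 = ∫ x, q x ∂lam) ∧
      ∀ P : ProbabilityMeasure G,
        (∀ h : G, (Ψ (P.map (measurable_const_mul h).aemeasurable) : Measure G) =
          (Ψ P : Measure G).map (h * ·)) →
        ∀ (q : C(G, ℝ)) (t : ℝ), 0 ≤ q →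
        (∀ A, MeasurableSet A →
          |(P : Measure G).real A - (FiniteMeasure.ofDensity lam q : Measure G).real A| ≤ t) →
        ∀ f : C(G, ℝ), |∫ x, f x ∂(Ψ P : Measure G) - S q f| ≤ 2 * t * ‖f‖ := by
  obtain ⟨B, hbil, hB⟩ := hΨ.exists_bilin lam
  refine ⟨averageBilin lam B, hbil.averageBilin lam, averageBilin_leftTranslate lam B,
    fun q f hq hf => ?_, fun q hq => ?_, fun P hP q t hq ht f => ?_⟩
  · rw [averageBilin]
    refine integral_nonneg fun h => ?_
    beta_reduce
    rw [hB _ (leftTranslate_nonneg h hq)]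
    exact integral_nonneg (leftTranslate_nonneg h hf)
  · have : ∀ h, B (leftTranslate h q) (leftTranslate h 1) = ∫ x, q x ∂lam := fun h => by
      rw [hB _ (leftTranslate_nonneg h hq)]
      have h1 := congrArg NNReal.toReal
        (mass_coneExtension (Ψ := Ψ) (FiniteMeasure.ofDensity lam (leftTranslate h q)))
      have h2 := FiniteMeasure.real_ofDensity lam (leftTranslate_nonneg h hq) MeasurableSet.univ
      rw [Measure.restrict_univ] at h2
      have h3 : ∫ x, q (h⁻¹ * x) ∂lam = ∫ x, q x ∂lam := integral_mul_left_eq_self _ _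
      simp only [leftTranslate_apply, one_apply, integral_const, smul_eq_mul, mul_one] at h2 ⊢
      rw [← h3, ← h2]
      exact h1
    simp [averageBilin, this]
  · have key : ∀ h, ‖∫ x, f x ∂(Ψ P : Measure G) - B (leftTranslate h q) (leftTranslate h f)‖ ≤
        2 * t * ‖f‖ := fun h => by
      rw [hB _ (leftTranslate_nonneg h hq)]
      -- Equivariance at `P` allows `P` and `f` to be translated together by `h`, so the estimate
      -- holds for each `h` before averaging.
      have h1 : ∫ x, f x ∂(Ψ P : Measure G) = ∫ x, leftTranslate h f x ∂(coneExtension Ψ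
          (P.map (measurable_const_mul h).aemeasurable).toFiniteMeasure : Measure G) := by
        rw [coneExtension_coe]
        change _ = ∫ x, leftTranslate h f x ∂(Ψ (P.map _) : Measure G)
        rw [hP, integral_map (measurable_const_mul h).aemeasurable
          (leftTranslate h f).continuous.aestronglyMeasurable]
        simp
      have ht0 : 0 ≤ t := (abs_nonneg _).trans (ht univ MeasurableSet.univ)
      rw [h1]
      refine (hΨ.abs_integral_coneExtension_sub_le _ _ (t := t) (fun A hA => ?_) _).trans ?_
      · rw [← map_mul_left_ofDensity]
        change |((P : Measure G).map (h * ·)).real A - _| ≤ t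
        rw [map_measureReal_apply (measurable_const_mul h) hA,
          map_measureReal_apply (measurable_const_mul h) hA]
        exact ht _ (measurable_const_mul h hA)
      · gcongr
        exact norm_leftTranslate_le h f
    have h2 := norm_integral_le_of_norm_le_const (μ := lam) (Eventually.of_forall key)
    rw [integral_sub (integrable_const _)
      ((hbil.continuous_leftTranslate _ _).integrable_of_compactSpace _)] at h2
    simpa [averageBilin] using h2

end Averaging

/-! ### Mollifiers, and invariant forms as functionals. -/

section ApproximateIdentity

open ContinuousMap

variable {G : Type*} [Group G] [TopologicalSpace G] [IsTopologicalGroup G]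
    [CompactSpace G] [T2Space G] [MeasurableSpace G] [BorelSpace G]

/-- `k` is a continuous probability density supported in `V`. -/
structure IsMollifier (lam : Measure G) (V : Set G) (k : C(G, ℝ)) : Prop where
  nonneg : 0 ≤ k
  integral_eq_one : ∫ x, k x ∂lam = 1
  eq_zero : ∀ x, x ∉ V → k x = 0

theorem exists_isMollifier (lam : Measure G) [IsFiniteMeasure lam] [lam.IsOpenPosMeasure]
    {V : Set G} (hV : V ∈ 𝓝 (1 : G)) : ∃ k, IsMollifier lam V k := by
  obtain ⟨f, hf1, hf0, hf⟩ := exists_continuous_zero_one_of_isClosed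
    (isOpen_interior (s := V)).isClosed_compl (isClosed_singleton (x := (1 : G)))
    (by simpa [mem_interior_iff_mem_nhds] using hV)
  have hpos : 0 < ∫ x, f x ∂lam :=
    f.continuous.integral_pos_of_hasCompactSupport_nonneg_nonzero
      (HasCompactSupport.of_compactSpace _) (fun x => (hf x).1)
      (x := 1) (by simp [hf0 (mem_singleton _)])
  refine ⟨(∫ x, f x ∂lam)⁻¹ • f, fun x => mul_nonneg (inv_nonneg.2 hpos.le) (hf x).1, ?_,
    fun x hx => ?_⟩
  · simp [integral_const_mul, hpos.ne']
  · have : f x = 0 := hf1 fun h => hx (interior_subset h)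
    simp [this]

variable [SecondCountableTopology G]
  (lam : Measure G) [IsProbabilityMeasure lam] [lam.IsMulLeftInvariant] [lam.IsInvInvariant]

theorem integrable_smul_leftTranslate (q k : C(G, ℝ)) (μ : Measure G) [IsFiniteMeasure μ] :
    Integrable (fun g => q g • leftTranslate g k) μ :=
  (q.continuous.smul (continuous_leftTranslate k)).integrable_of_compactSpace μ

/-- The integral is the convolution of `q` with `k`. `V` is chosen so that right translation by its
elements moves `q` by less than `ε` uniformly, and only `g` with `g⁻¹ * x ∈ V` contribute at `x`. -/
theorem exists_norm_integral_smul_leftTranslate_sub_le (q : C(G, ℝ)) {ε : ℝ} (hε : 0 < ε) :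
    ∃ V ∈ 𝓝 (1 : G), ∀ k, IsMollifier lam V k →
      ‖∫ g, q g • leftTranslate g k ∂lam - q‖ ≤ ε := by
  have hcont : Continuous fun v : G => q.comp (ContinuousMap.mulRight v) := by
    refine continuous_of_continuous_uncurry _ ?_
    change Continuous fun p : G × G => q (p.2 * p.1)
    fun_prop
  have hlim : Tendsto (fun v : G => ‖q.comp (ContinuousMap.mulRight v) - q‖) (𝓝 1) (𝓝 0) := by
    have h : Tendsto (fun v : G => ‖q.comp (ContinuousMap.mulRight v) - q‖) (𝓝 1)
        (𝓝 ‖q.comp (ContinuousMap.mulRight 1) - q‖) :=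
      ((hcont.sub (continuous_const (y := q))).norm).tendsto 1
    have h1 : q.comp (ContinuousMap.mulRight 1) = q := by ext; simp
    rwa [h1, sub_self, norm_zero] at h
  refine ⟨_, hlim.eventually (Iio_mem_nhds hε), fun k hk => ?_⟩
  refine (ContinuousMap.norm_le _ hε.le).2 fun x => ?_
  have hone : ∫ g, k (g⁻¹ * x) ∂lam = 1 := by
    rw [← hk.integral_eq_one, ← integral_inv_eq_self (μ := lam) (fun g => k g),
      ← integral_mul_left_eq_self (μ := lam) (fun g => k g⁻¹) x⁻¹]
    simp
  have hk0 : ∀ y, 0 ≤ k y := hk.nonneg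
  have hi : Integrable (fun g => k (g⁻¹ * x)) lam :=
    (by fun_prop : Continuous fun g => k (g⁻¹ * x)).integrable_of_compactSpace lam
  have hi2 : Integrable (fun g => q g * k (g⁻¹ * x)) lam :=
    (by fun_prop : Continuous fun g => q g * k (g⁻¹ * x)).integrable_of_compactSpace lam
  rw [ContinuousMap.sub_apply, ContinuousMap.integral_apply (integrable_smul_leftTranslate _ _ _)]
  have hq : q x = ∫ g, q x * k (g⁻¹ * x) ∂lam := by
    rw [integral_const_mul, hone, mul_one]
  rw [hq]
  simp only [ContinuousMap.smul_apply, leftTranslate_apply, smul_eq_mul]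
  rw [← integral_sub hi2 (hi.const_mul _)]
  calc ‖∫ g, q g * k (g⁻¹ * x) - q x * k (g⁻¹ * x) ∂lam‖
      ≤ ∫ g, ε * k (g⁻¹ * x) ∂lam := by
        refine norm_integral_le_of_norm_le (hi.const_mul ε) (Eventually.of_forall fun g => ?_)
        rw [← sub_mul, norm_mul, Real.norm_of_nonneg (hk0 _)]
        by_cases hg : g⁻¹ * x ∈ {v : G | ‖q.comp (ContinuousMap.mulRight v) - q‖ ∈ Iio ε}
        · refine mul_le_mul_of_nonneg_right ?_ (hk0 _)
          have h1 := (ContinuousMap.norm_coe_le_norm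
            (q.comp (ContinuousMap.mulRight (g⁻¹ * x)) - q) g).trans (le_of_lt hg)
          rw [norm_sub_rev]
          simpa using h1
        · rw [hk.eq_zero _ hg]
          simp
    _ = ε := by rw [integral_const_mul, hone, mul_one]

/-- A left-invariant positive bounded bilinear form is represented by a positive functional. -/
theorem exists_functional_of_invariant_bilin [lam.IsOpenPosMeasure] {S : C(G, ℝ) → C(G, ℝ) → ℝ}
    (hS : IsBoundedBilinearMap ℝ (fun p : C(G, ℝ) × C(G, ℝ) => S p.1 p.2))
    (hinv : ∀ g q f, S (leftTranslate g q) f = S q (leftTranslate g⁻¹ f))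
    (hpos : ∀ q f, 0 ≤ q → 0 ≤ f → 0 ≤ S q f)
    (hone : ∀ q, 0 ≤ q → S q 1 = ∫ x, q x ∂lam) :
    ∃ L : C(G, ℝ) →L[ℝ] ℝ, (∀ f, 0 ≤ f → 0 ≤ L f) ∧ L 1 = 1 ∧
      ∀ q f, S q f = ∫ g, q g * L (leftTranslate g⁻¹ f) ∂lam := by
  have hright := fun q => hS.isBoundedLinearMap_right q
  have hleft := fun f => hS.isBoundedLinearMap_left f
  obtain ⟨u, hu⟩ := (𝓝 (1 : G)).exists_antitone_basis
  choose k hk using fun n => exists_isMollifier lam (hu.mem n)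
  -- The functional is `f ↦ lim S (k n) f`. Along an ultrafilter the limit of a bounded sequence
  -- exists for all `f` at once, and it is linear in `f`.
  let F : Ultrafilter ℕ := hyperfilter ℕ
  have hF : ∀ W ∈ 𝓝 (1 : G), ∀ᶠ n in (F : Filter ℕ), u n ⊆ W := fun W hW =>
    Nat.hyperfilter_le_atTop (hu.eventually_subset hW)
  have hbound : ∀ V (q f : C(G, ℝ)), IsMollifier lam V q → |S q f| ≤ ‖f‖ := by
    intro V q f hq
    have h1 : S q (‖f‖ • 1) = ‖f‖ := by
      rw [(hright q).map_smul, hone q hq.nonneg, hq.integral_eq_one]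
      simp
    have hf : ∀ x, |f x| ≤ ‖f‖ := fun x => f.norm_coe_le_norm x
    have h2 := hpos q (‖f‖ • 1 - f) hq.nonneg (fun x => by
      simpa using (le_abs_self _).trans (hf x))
    have h3 := hpos q (‖f‖ • 1 + f) hq.nonneg (fun x => by
      have := (neg_le_abs _).trans (hf x)
      change 0 ≤ ‖f‖ * 1 + f x
      linarith)
    rw [(hright q).map_sub, h1] at h2
    rw [(hright q).map_add, h1] at h3
    exact abs_le.2 ⟨by linarith, by linarith⟩
  have hlim : ∀ f, ∃ l : ℝ, Tendsto (fun n => S (k n) f) F (𝓝 l) := fun f => by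
    obtain ⟨l, _, hl⟩ := (isCompact_Icc (a := -‖f‖) (b := ‖f‖)).ultrafilter_le_nhds
      (F.map fun n => S (k n) f)
      (le_principal_iff.2 (Filter.mem_map.2 (univ_mem' fun n =>
        abs_le.1 (hbound _ _ f (hk n)))))
    exact ⟨l, hl⟩
  choose l hl using hlim
  have huniq : ∀ {a b : ℝ} {u : ℕ → ℝ}, Tendsto u F (𝓝 a) → Tendsto u F (𝓝 b) → a = b :=
    fun h h' => tendsto_nhds_unique h h'
  let L : C(G, ℝ) →L[ℝ] ℝ := LinearMap.mkContinuous
    { toFun := l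
      map_add' := fun f g => huniq (hl (f + g)) (by
        simp_rw [fun n => (hright (k n)).map_add f g]
        exact (hl f).add (hl g))
      map_smul' := fun c f => huniq (hl (c • f)) (by
        simp_rw [fun n => (hright (k n)).map_smul c f]
        exact (hl f).const_smul c) } 1 (fun f => by
      rw [one_mul]
      exact le_of_tendsto (hl f).abs (Eventually.of_forall fun n => hbound _ _ f (hk n)))
  refine ⟨L, fun f hf => ge_of_tendsto (hl f) (Eventually.of_forall fun n =>
      hpos _ _ (hk n).nonneg hf),
    huniq (hl 1) (tendsto_const_nhds.congr' (Eventually.of_forall fun n => ?_)), fun q f => ?_⟩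
  · beta_reduce
    rw [hone _ (hk n).nonneg, (hk n).integral_eq_one]
  have hcont : Continuous fun g : G => q g • leftTranslate g⁻¹ f :=
    q.continuous.smul ((continuous_leftTranslate f).comp continuous_inv)
  have hint := hcont.integrable_of_compactSpace lam
  have hconv : Tendsto (fun n => ∫ g, q g • leftTranslate g (k n) ∂lam) F (𝓝 q) := by
    rw [tendsto_iff_norm_sub_tendsto_zero]
    refine Metric.tendsto_nhds.2 fun ε hε => ?_
    obtain ⟨W, hW, h⟩ := exists_norm_integral_smul_leftTranslate_sub_le lam q (half_pos hε)
    filter_upwards [hF W hW] with n hn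
    rw [dist_zero_right, norm_norm]
    refine (h (k n) ⟨(hk n).nonneg, (hk n).integral_eq_one,
      fun x hx => (hk n).eq_zero x fun h => hx (hn h)⟩).trans_lt (half_lt_self hε)
  have h1 : Tendsto (fun n => S (∫ g, q g • leftTranslate g (k n) ∂lam) f) F (𝓝 (S q f)) :=
    ((hleft f).continuous.tendsto q).comp hconv
  -- Write `q` approximately as a superposition of translates of `k n`; invariance moves the
  -- translation from `k n` onto `f`, leaving `S (k n)` applied to a fixed function.
  have h2 : ∀ n, S (∫ g, q g • leftTranslate g (k n) ∂lam) f =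
      S (k n) (∫ g, q g • leftTranslate g⁻¹ f ∂lam) := fun n => by
    have e1 := ((hleft f).toContinuousLinearMap).integral_comp_comm
      (integrable_smul_leftTranslate q (k n) lam)
    have e2 := ((hright (k n)).toContinuousLinearMap).integral_comp_comm hint
    refine e1.symm.trans (Eq.trans ?_ e2)
    refine integral_congr_ae (Eventually.of_forall fun g => ?_)
    change S (q g • leftTranslate g (k n)) f = S (k n) (q g • leftTranslate g⁻¹ f)
    rw [(hleft f).map_smul, (hright (k n)).map_smul, hinv]
  simp_rw [h2] at h1
  rw [huniq h1 (hl _)]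
  change L _ = _
  rw [← L.integral_comp_comm hint]
  simp

end ApproximateIdentity

/-! ### Affine maps as convolution operators. -/

section Convolution

open ContinuousMap

variable {G : Type*} [Group G] [TopologicalSpace G] [IsTopologicalGroup G]
    [CompactSpace G] [T2Space G] [SecondCountableTopology G] [MeasurableSpace G] [BorelSpace G]

omit [Group G] [IsTopologicalGroup G] [SecondCountableTopology G] in
theorem exists_probabilityMeasure_of_positive (L : C(G, ℝ) →L[ℝ] ℝ) (hL : ∀ f, 0 ≤ f → 0 ≤ L f)
    (h1 : L 1 = 1) :
    ∃ ν : Measure G, IsProbabilityMeasure ν ∧ ∀ f : C(G, ℝ), L f = ∫ x, f x ∂ν := by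
  let Λ : CompactlySupportedContinuousMap G ℝ →ₚ[ℝ] ℝ := PositiveLinearMap.mk₀
    { toFun := fun f => L f.toContinuousMap
      map_add' := fun f g => L.map_add f.toContinuousMap g.toContinuousMap
      map_smul' := fun c f => L.map_smul c f.toContinuousMap }
    (fun f hf => hL _ hf)
  have key : ∀ f : C(G, ℝ), L f = ∫ x, f x ∂(RealRMK.rieszMeasure Λ) := fun f =>
    (RealRMK.integral_rieszMeasure Λ (CompactlySupportedContinuousMap.continuousMapEquiv f)).symm
  refine ⟨RealRMK.rieszMeasure Λ, ⟨?_⟩, key⟩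
  have := key 1
  rw [h1] at this
  simp only [ContinuousMap.one_apply, integral_const, smul_eq_mul, mul_one] at this
  rw [measureReal_def, eq_comm, ENNReal.toReal_eq_one_iff] at this
  exact this

/-- By the Riesz representation the functional is integration against some `ν`, so the averaged form
is `∫ f d(qλ ∗ ν)`. One `ν` serves every `P` that satisfies the two conditions, since both sides are
Lipschitz in total variation. -/
theorem IsAffineMap.exists_eq_mconv (lam : Measure G) [IsProbabilityMeasure lam]
    [lam.IsMulLeftInvariant] [lam.IsMulRightInvariant] [lam.IsInvInvariant]
    [lam.IsOpenPosMeasure]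
    {Ψ : ProbabilityMeasure G → ProbabilityMeasure G} (hΨ : IsAffineMap Ψ) :
    ∃ ν : Measure G, IsProbabilityMeasure ν ∧ ∀ P : ProbabilityMeasure G,
      (∀ h : G, (Ψ (P.map (measurable_const_mul h).aemeasurable) : Measure G) =
          (Ψ P : Measure G).map (h * ·)) →
      (∀ t > 0, ∃ q : C(G, ℝ), 0 ≤ q ∧ ∀ A, MeasurableSet A →
        |(P : Measure G).real A - (FiniteMeasure.ofDensity lam q : Measure G).real A| ≤ t) →
      (Ψ P : Measure G) = (P : Measure G).mconv ν := by
  obtain ⟨S, hS, hinv, hpos, hone, hP⟩ := hΨ.exists_invariant_bilin lam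
  obtain ⟨L, hL, hL1, hSL⟩ := exists_functional_of_invariant_bilin lam hS hinv hpos hone
  obtain ⟨ν, hν, hLν⟩ := exists_probabilityMeasure_of_positive L hL hL1
  refine ⟨ν, hν, fun P hcov happrox => ?_⟩
  refine ext_of_forall_integral_eq_of_IsFiniteMeasure fun f' => ?_
  obtain ⟨f, rfl⟩ : ∃ f : C(G, ℝ), f' = BoundedContinuousFunction.mkOfCompact f :=
    ⟨f'.toContinuousMap, rfl⟩
  simp only [BoundedContinuousFunction.mkOfCompact_apply]
  rw [integral_mconv (f.integrable_of_isFiniteMeasure _)]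
  let ψ : C(G, ℝ) := ⟨fun g => L (leftTranslate g⁻¹ f),
    L.continuous.comp ((continuous_leftTranslate f).comp continuous_inv)⟩
  have hψ : ∀ g, ψ g = ∫ y, f (g * y) ∂ν := fun g => by
    change L _ = _
    rw [hLν]
    simp
  simp_rw [← hψ]
  refine eq_of_forall_dist_le fun ε hε => ?_
  -- Errors `2t‖f‖` for `Ψ P` and `2t‖ψ‖` for `P ∗ ν` must sum to at most `ε`; the `1` keeps the
  -- denominator positive.
  have hd : 0 < 2 * ‖f‖ + 2 * ‖ψ‖ + 1 := by positivity
  obtain ⟨q, hq, hqt⟩ := happrox (ε / (2 * ‖f‖ + 2 * ‖ψ‖ + 1)) (by positivity)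
  set t := ε / (2 * ‖f‖ + 2 * ‖ψ‖ + 1) with ht
  have hε' : ε = t * (2 * ‖f‖ + 2 * ‖ψ‖ + 1) := by rw [ht]; field_simp
  have ht0 : 0 < t := by positivity
  have e1 := hP P hcov q t hq hqt f
  have e2 := FiniteMeasure.abs_integral_sub_le P.toFiniteMeasure _ hqt ψ
  rw [FiniteMeasure.integral_ofDensity lam hq] at e2
  have e3 : S q f = ∫ x, q x * ψ x ∂lam := hSL q f
  rw [← e3] at e2
  change |∫ x, ψ x ∂(P : Measure G) - _| ≤ _ at e2
  rw [Real.dist_eq]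
  rw [abs_le] at *
  constructor <;> nlinarith

end Convolution

/-! ### Pure states and the quadratic forms of an observable. -/

section VectorStates

variable {H : Type*} [NormedAddCommGroup H] [InnerProductSpace ℂ H] [CompleteSpace H]

theorem hasSum_inner_rankOne_mul (v : H) (A : H →L[ℂ] H) {ι : Type*} (b : HilbertBasis ι ℂ H) :
    HasSum (fun i => ⟪b i, (InnerProductSpace.rankOne ℂ v v * A) (b i)⟫_ℂ) ⟪v, A v⟫_ℂ := by
  have h := b.hasSum_inner_mul_inner (ContinuousLinearMap.adjoint A v) v
  rw [ContinuousLinearMap.adjoint_inner_left] at h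
  have e : ∀ i, ⟪b i, (InnerProductSpace.rankOne ℂ v v * A) (b i)⟫_ℂ =
      ⟪ContinuousLinearMap.adjoint A v, b i⟫_ℂ * ⟪b i, v⟫_ℂ := fun i => by
    rw [ContinuousLinearMap.adjoint_inner_left, mul_apply_eq_comp,
      InnerProductSpace.rankOne_apply, inner_smul_right]
  simp_rw [e]
  exact h

/-- The pure state of a unit vector. -/
noncomputable def QState.ofUnitVector (v : H) (hv : ‖v‖ = 1) : QState H where
  op := InnerProductSpace.rankOne ℂ v v
  nonneg := (ContinuousLinearMap.nonneg_iff_isPositive _).2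
    (InnerProductSpace.isPositive_rankOne_self v)
  traceClass := by
    rw [IsTraceClass, CFC.abs_of_nonneg _ ((ContinuousLinearMap.nonneg_iff_isPositive _).2
      (InnerProductSpace.isPositive_rankOne_self v))]
    simpa using (hasSum_inner_rankOne_mul v 1 (stdBasis H)).summable
  trace_eq_one := by
    have h := (hasSum_inner_rankOne_mul v 1 (stdBasis H)).tsum_eq
    rw [mul_one] at h
    rw [opTrace, h]
    simp [hv]

namespace Observable

variable {Ω : Type*} [MeasurableSpace Ω]

theorem real_outcomeDistribution_ofUnitVector (E : Observable Ω H) (v : H) (hv : ‖v‖ = 1)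
    {X : Set Ω} (hX : MeasurableSet X) :
    (E.outcomeDistribution (QState.ofUnitVector v hv) : Measure Ω).real X = (⟪v, E X v⟫_ℂ).re := by
  have h := E.outcomeDistribution_apply (QState.ofUnitVector v hv) hX
  have h2 : opTrace ((QState.ofUnitVector v hv).op * E X) = ⟪v, E X v⟫_ℂ :=
    (hasSum_inner_rankOne_mul v (E X) (stdBasis H)).tsum_eq
  rw [← h2, ← h, Complex.ofReal_re]

theorem norm_le_one (E : Observable Ω H) {X : Set Ω} (hX : MeasurableSet X) : ‖E X‖ ≤ 1 :=
  (CStarAlgebra.norm_le_one_iff_of_nonneg _ (E.nonneg' X hX)).2 (E.le_one' X hX)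

theorem abs_real_outcomeDistribution_sub_le (E : Observable Ω H) {v w : H} (hv : ‖v‖ = 1)
    (hw : ‖w‖ = 1) {X : Set Ω} (hX : MeasurableSet X) :
    |(E.outcomeDistribution (QState.ofUnitVector v hv) : Measure Ω).real X -
      (E.outcomeDistribution (QState.ofUnitVector w hw) : Measure Ω).real X| ≤ 2 * ‖v - w‖ := by
  rw [real_outcomeDistribution_ofUnitVector E v hv hX,
    real_outcomeDistribution_ofUnitVector E w hw hX, ← Complex.sub_re]
  refine (Complex.abs_re_le_norm _).trans ?_
  have h : ⟪v, E X v⟫_ℂ - ⟪w, E X w⟫_ℂ = ⟪v - w, E X v⟫_ℂ + ⟪w, E X (v - w)⟫_ℂ := by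
    simp only [inner_sub_left, map_sub, inner_sub_right]
    ring
  have h1 : ∀ u, ‖E X u‖ ≤ ‖u‖ := fun u => by
    simpa using (E X).le_of_opNorm_le (E.norm_le_one hX) u
  rw [h]
  calc _ ≤ ‖⟪v - w, E X v⟫_ℂ‖ + ‖⟪w, E X (v - w)⟫_ℂ‖ := norm_add_le _ _
    _ ≤ ‖v - w‖ * ‖v‖ + ‖w‖ * ‖v - w‖ := add_le_add
        ((norm_inner_le_norm _ _).trans (by gcongr; exact h1 _))
        ((norm_inner_le_norm _ _).trans (by gcongr; exact h1 _))
    _ = 2 * ‖v - w‖ := by rw [hv, hw]; ring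

/-- Pure states suffice: on a complex space an operator is determined by its quadratic form, by
polarization. -/
theorem eq_of_outcomeDistribution_ofUnitVector_eq {E F : Observable Ω H} {X Y : Set Ω}
    (hX : MeasurableSet X) (hY : MeasurableSet Y)
    (h : ∀ v (hv : ‖v‖ = 1), (E.outcomeDistribution (QState.ofUnitVector v hv) : Measure Ω).real X =
      (F.outcomeDistribution (QState.ofUnitVector v hv) : Measure Ω).real Y) : E X = F Y := by
  have key : ∀ v, ‖v‖ = 1 → ⟪v, E X v⟫_ℂ = ⟪v, F Y v⟫_ℂ := fun v hv => by
    have h1 := h v hv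
    rw [real_outcomeDistribution_ofUnitVector E v hv hX,
      real_outcomeDistribution_ofUnitVector F v hv hY] at h1
    obtain ⟨r, hr⟩ := E.inner_eq_ofReal hX v
    obtain ⟨s, hs⟩ := F.inner_eq_ofReal hY v
    rw [hr, hs] at h1 ⊢
    simpa using h1
  have key2 : ∀ v, ⟪v, E X v⟫_ℂ = ⟪v, F Y v⟫_ℂ := fun v => by
    rcases eq_or_ne v 0 with rfl | hv
    · simp
    have hn : (‖v‖ : ℂ) ≠ 0 := by simpa using hv
    have h1 := key ((‖v‖ : ℂ)⁻¹ • v) (by simp [norm_smul, hv])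
    simp only [map_smul, inner_smul_left, inner_smul_right] at h1
    have hn2 : (starRingEnd ℂ) (‖v‖ : ℂ)⁻¹ ≠ 0 := by simpa using hv
    exact mul_left_cancel₀ hn2 (mul_left_cancel₀ (inv_ne_zero hn) h1)
  refine ContinuousLinearMap.coe_injective ((ext_inner_map _ _).1 fun v => ?_)
  have := congrArg (starRingEnd ℂ) (key2 v)
  simpa only [inner_conj_symm, ContinuousLinearMap.coe_coe] using this

/-- With `S = √A` one has `⟪v, A v⟫ = ‖S v‖²` and `‖S‖ = 1`, so a vector nearly attaining the norm
of `S` works. -/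
theorem exists_unitVector_of_norm_eq_one {A : H →L[ℂ] H} (h0 : 0 ≤ A) (hA : ‖A‖ = 1)
    {ε : ℝ} (hε : 0 < ε) : ∃ v : H, ‖v‖ = 1 ∧ 1 - ε < (⟪v, A v⟫_ℂ).re := by
  set S := CFC.sqrt A with hS
  have hS0 : IsSelfAdjoint S := IsSelfAdjoint.of_nonneg (CFC.sqrt_nonneg A)
  have hSS : S * S = A := CFC.sqrt_mul_sqrt_self A h0
  have hSnorm : ‖S‖ = 1 := by
    have := hS0.norm_mul_self
    rw [hSS, hA] at this
    nlinarith [norm_nonneg S]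
  have hinner : ∀ v, (⟪v, A v⟫_ℂ).re = ‖S v‖ ^ 2 := fun v => by
    rw [← hSS, mul_apply_eq_comp, ← ContinuousLinearMap.adjoint_inner_left, hS0.adjoint_eq,
      inner_self_eq_norm_sq_to_K]
    norm_cast
  -- Squaring `1 - δ/2` gives at least `1 - δ`; capping `δ` at `1` keeps the bound nonnegative.
  have hlt : 1 - min ε 1 / 2 < ‖S‖ := by
    rw [hSnorm]
    have : 0 < min ε 1 := lt_min hε one_pos
    linarith
  obtain ⟨w, hw⟩ : ∃ w, (1 - min ε 1 / 2) * ‖w‖ < ‖S w‖ := by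
    by_contra! hcon
    refine absurd (S.opNorm_le_bound ?_ hcon) (not_le.2 hlt)
    have : min ε 1 ≤ 1 := min_le_right _ _
    linarith
  have hmin : min ε 1 ≤ 1 := min_le_right _ _
  have hmin2 : min ε 1 ≤ ε := min_le_left _ _
  have hmin0 : 0 < min ε 1 := lt_min hε one_pos
  have hw0 : w ≠ 0 := by
    rintro rfl
    simp at hw
  have hwn : 0 < ‖w‖ := norm_pos_iff.2 hw0
  refine ⟨(‖w‖ : ℂ)⁻¹ • w, by simp [norm_smul, hwn.ne'], ?_⟩
  rw [hinner, map_smul, norm_smul]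
  have : 1 - min ε 1 / 2 < ‖w‖⁻¹ * ‖S w‖ := by
    rw [inv_mul_eq_div, lt_div_iff₀ hwn]
    exact hw
  simp only [norm_inv, Complex.norm_real, norm_norm]
  nlinarith

end Observable

end VectorStates

/-! ### Unitary orbits and translated outcome distributions. -/

section Covariance

variable {H : Type*} [NormedAddCommGroup H] [InnerProductSpace ℂ H] [CompleteSpace H]

theorem star_unitary_apply_apply (u : unitary (H →L[ℂ] H)) (v : H) :
    star (u : H →L[ℂ] H) ((u : H →L[ℂ] H) v) = v := by
  rw [← mul_apply_eq_comp, Unitary.coe_star_mul_self, one_apply_eq_self]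

theorem norm_unitary_apply (u : unitary (H →L[ℂ] H)) (v : H) : ‖(u : H →L[ℂ] H) v‖ = ‖v‖ := by
  have h : ⟪(u : H →L[ℂ] H) v, (u : H →L[ℂ] H) v⟫_ℂ = ⟪v, v⟫_ℂ := by
    rw [← ContinuousLinearMap.adjoint_inner_left, ← ContinuousLinearMap.star_eq_adjoint,
      star_unitary_apply_apply]
  rw [@norm_eq_sqrt_re_inner ℂ, @norm_eq_sqrt_re_inner ℂ, h]

namespace Observable

variable {G : Type*} [Group G] [TopologicalSpace G] [IsTopologicalGroup G]
    [MeasurableSpace G] [BorelSpace G] {U : G →* unitary (H →L[ℂ] H)} {E : Observable G H}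

theorem outcomeDistribution_unitary_apply (hE : E ∈ covariant U) (h : G) {v : H} (hv : ‖v‖ = 1)
    (hv' : ‖(U h : H →L[ℂ] H) v‖ = 1) :
    E.outcomeDistribution (QState.ofUnitVector ((U h : H →L[ℂ] H) v) hv') =
      (E.outcomeDistribution (QState.ofUnitVector v hv)).map
        (measurable_const_mul h).aemeasurable := by
  refine Subtype.ext (Measure.ext fun X hX => ?_)
  have hY : MeasurableSet ((h * ·) ⁻¹' X) := measurable_const_mul h hX
  have hXY : h • ((h * ·) ⁻¹' X) = X := by
    ext x
    simp [mem_smul_set_iff_inv_smul_mem]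
  refine (ENNReal.toReal_eq_toReal_iff' (measure_ne_top (ProbabilityMeasure.toMeasure _) X)
    (measure_ne_top (ProbabilityMeasure.toMeasure _) X)).1 ?_
  refine (real_outcomeDistribution_ofUnitVector E _ hv' hX).trans ?_
  refine Eq.trans ?_ (map_measureReal_apply (measurable_const_mul h) hX).symm
  refine Eq.trans ?_ (real_outcomeDistribution_ofUnitVector E _ hv hY).symm
  have hcov := hE h _ hY
  rw [hXY] at hcov
  rw [← hcov, mul_apply_eq_comp, mul_apply_eq_comp, star_unitary_apply_apply,
    ← ContinuousLinearMap.adjoint_inner_left, ← ContinuousLinearMap.star_eq_adjoint,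
    star_unitary_apply_apply]

end Observable

end Covariance

/-! ### Concentration forces a point mass. -/

section Dirac

variable {G : Type*} [Group G] [TopologicalSpace G] [IsTopologicalGroup G]
    [T2Space G] [SecondCountableTopology G] [MeasurableSpace G] [BorelSpace G]

/-- A probability measure that is almost concentrated on translates of arbitrarily small
neighbourhoods of the identity is a point mass. -/
theorem exists_eq_dirac_of_concentrated (ν : Measure G) [IsProbabilityMeasure ν]
    (h : ∀ V : Set G, IsOpen V → (1 : G) ∈ V → ∀ ε : ℝ, 0 < ε →
      ∃ g, 1 - ε < ν.real ((g * ·) ⁻¹' V)) : ∃ x, ν = Measure.dirac x := by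
  obtain ⟨x, hx⟩ := Measure.nonempty_support (IsProbabilityMeasure.ne_zero ν)
  have hsupp : ν.support ⊆ {x} := by
    intro y hy
    by_contra hne
    -- If `z` is near `x`, `w` is near `y` and both `g z`, `g w` are near `1`, then `(g z) z⁻¹ w (g
    -- w)⁻¹ = 1`, while by continuity this expression stays near `x⁻¹ y ≠ 1`.
    have hcont : Continuous fun p : (G × G) × (G × G) => p.2.1 * p.1.1⁻¹ * p.1.2 * p.2.2⁻¹ := by
      fun_prop
    have hev : ∀ᶠ p in 𝓝 (((x, y), (1, 1)) : (G × G) × (G × G)),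
        p.2.1 * p.1.1⁻¹ * p.1.2 * p.2.2⁻¹ ≠ 1 := by
      refine hcont.continuousAt.eventually_ne ?_
      simp only [one_mul, inv_one, mul_one, ne_eq, inv_mul_eq_one]
      exact fun h => hne h.symm
    rw [nhds_prod_eq, eventually_prod_iff] at hev
    obtain ⟨p, hp, q, hq, hpq⟩ := hev
    rw [nhds_prod_eq, eventually_prod_iff] at hp hq
    obtain ⟨a, ha, b, hb, hab⟩ := hp
    obtain ⟨c, hc, d, hd, hcd⟩ := hq
    have hA := (Measure.mem_support_iff_forall x).1 hx _ ha
    have hB := (Measure.mem_support_iff_forall y).1 hy _ hb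
    obtain ⟨V, hVsub, hVo, hV1⟩ := mem_nhds_iff.1 (hc.and hd)
    have hA' : 0 < ν.real {z | a z} := ENNReal.toReal_pos hA.ne' (measure_ne_top _ _)
    have hB' : 0 < ν.real {z | b z} := ENNReal.toReal_pos hB.ne' (measure_ne_top _ _)
    -- With this tolerance the translate of `V` has too much mass to miss either neighbourhood.
    obtain ⟨g, hg⟩ := h V hVo hV1 _ (lt_min hA' hB')
    have hD : MeasurableSet ((g * ·) ⁻¹' V) := measurable_const_mul g hVo.measurableSet
    have hinter : ∀ s : Set G, min (ν.real {z | a z}) (ν.real {z | b z}) ≤ ν.real s →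
        (s ∩ ((g * ·) ⁻¹' V)).Nonempty := fun s hs => by
      by_contra hemp
      rw [not_nonempty_iff_eq_empty, ← disjoint_iff_inter_eq_empty] at hemp
      have h1 := measureReal_union (μ := ν) hemp hD
      have h2 : ν.real (s ∪ (g * ·) ⁻¹' V) ≤ 1 := measureReal_le_one
      linarith
    obtain ⟨z, hz, hzV⟩ := hinter _ (min_le_left _ _)
    obtain ⟨w, hw, hwV⟩ := hinter _ (min_le_right _ _)
    refine hpq (hab hz hw) (hcd (hVsub hzV).1 (hVsub hwV).2) ?_
    simp [mul_assoc]
  have hnull : ν {x}ᶜ = 0 :=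
    measure_mono_null (compl_subset_compl.2 hsupp) Measure.measure_compl_support
  refine ⟨x, Measure.ext fun A hA => ?_⟩
  rw [Measure.dirac_apply' _ hA]
  by_cases hxA : x ∈ A
  · have : ν Aᶜ = 0 := measure_mono_null (by simpa using hxA) hnull
    rw [prob_compl_eq_zero_iff hA] at this
    simp [this, hxA]
  · simpa [hxA] using measure_mono_null (subset_compl_singleton_iff.2 hxA) hnull

-- The value `(P ∗ ν) V` is the `P`-average of `ν (g⁻¹ V)`, and an average cannot exceed a common
-- upper bound.
omit [T2Space G] in
theorem exists_real_preimage_of_mconv (P ν : Measure G) [IsProbabilityMeasure P]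
    [IsProbabilityMeasure ν] {V : Set G} (hV : MeasurableSet V) {c : ℝ}
    (h : c < (P ∗ₘ ν).real V) : ∃ g, c < ν.real ((g * ·) ⁻¹' V) := by
  by_contra! hcon
  refine not_le.2 h ?_
  have hc : 0 ≤ c := measureReal_nonneg.trans (hcon 1)
  refine ENNReal.toReal_le_of_le_ofReal hc ?_
  rw [← lintegral_indicator_one hV, Measure.lintegral_mconv (measurable_one.indicator hV)]
  have : ∀ g, ∫⁻ y, V.indicator 1 (g * y) ∂ν ≤ ENNReal.ofReal c := fun g => by
    have e : ∫⁻ y, V.indicator 1 (g * y) ∂ν = ν ((g * ·) ⁻¹' V) := by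
      rw [← lintegral_indicator_one (measurable_const_mul g hV)]
      rfl
    rw [e, ← ofReal_measureReal]
    exact ENNReal.ofReal_le_ofReal (hcon g)
  refine (lintegral_mono this).trans ?_
  simp

end Dirac

/-! ### Approximation by continuous densities. -/

section Approximation

open ContinuousMap

variable {G : Type*} [Group G] [TopologicalSpace G] [IsTopologicalGroup G]
    [CompactSpace G] [T2Space G] [SecondCountableTopology G] [MeasurableSpace G] [BorelSpace G]
  (lam : Measure G) [IsProbabilityMeasure lam] [lam.IsMulRightInvariant]

/-- Convolution of a continuous density with a probability measure. -/
theorem exists_density_convolution (P : Measure G) [IsProbabilityMeasure P] {k : C(G, ℝ)}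
    (hk : 0 ≤ k) : ∃ q : C(G, ℝ), 0 ≤ q ∧ ∀ A, MeasurableSet A →
      (FiniteMeasure.ofDensity lam q : Measure G).real A =
        ∫ x, k x * P.real ((x * ·) ⁻¹' A) ∂lam := by
  have hcont : Continuous fun y : G => k.comp (ContinuousMap.mulRight y⁻¹) := by
    refine continuous_of_continuous_uncurry _ ?_
    change Continuous fun p : G × G => k (p.2 * p.1⁻¹)
    fun_prop
  have hk0 : ∀ x, 0 ≤ k x := hk
  have hq : ∀ x, (∫ y, k.comp (ContinuousMap.mulRight y⁻¹) ∂P) x = ∫ y, k (x * y⁻¹) ∂P := fun x =>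
    ContinuousMap.integral_apply (hcont.integrable_of_compactSpace P) x
  have hq0 : 0 ≤ ∫ y, k.comp (ContinuousMap.mulRight y⁻¹) ∂P := fun x => by
    change 0 ≤ (∫ y, k.comp (ContinuousMap.mulRight y⁻¹) ∂P) x
    rw [hq]
    exact integral_nonneg fun y => hk0 _
  refine ⟨_, hq0, fun A hA => ?_⟩
  rw [FiniteMeasure.real_ofDensity lam hq0 hA, ← integral_indicator hA]
  have hbdd : ∀ x : G, |A.indicator (1 : G → ℝ) x| ≤ 1 := fun x => by
    by_cases hx : x ∈ A <;> simp [hx]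
  have hmeas : Measurable (A.indicator (1 : G → ℝ)) := measurable_one.indicator hA
  have h1 : ∀ x, A.indicator (fun x => (∫ y, k.comp (ContinuousMap.mulRight y⁻¹) ∂P) x) x =
      ∫ y, A.indicator 1 x * k (x * y⁻¹) ∂P := fun x => by
    rw [integral_const_mul, ← hq]
    by_cases hx : x ∈ A <;> simp [hx]
  have hint1 : Integrable (fun p : G × G => A.indicator 1 p.1 * k (p.1 * p.2⁻¹)) (lam.prod P) := by
    refine Integrable.of_bound (C := ‖k‖) ?_ (Eventually.of_forall fun p => ?_)
    · exact ((hmeas.comp measurable_fst).mul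
        (by fun_prop : Continuous fun p : G × G => k (p.1 * p.2⁻¹)).measurable).aestronglyMeasurable
    · rw [norm_mul]
      exact (mul_le_mul (hbdd _) (k.norm_coe_le_norm _) (norm_nonneg _) zero_le_one).trans
        (one_mul _).le
  have hint2 : Integrable (fun p : G × G => A.indicator 1 (p.2 * p.1) * k p.2) (P.prod lam) := by
    refine Integrable.of_bound (C := ‖k‖) ?_ (Eventually.of_forall fun p => ?_)
    · exact ((hmeas.comp (measurable_snd.mul measurable_fst)).mul
        (k.continuous.measurable.comp measurable_snd)).aestronglyMeasurable
    · rw [norm_mul]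
      exact (mul_le_mul (hbdd _) (k.norm_coe_le_norm _) (norm_nonneg _) zero_le_one).trans
        (one_mul _).le
  calc ∫ x, A.indicator (fun x => (∫ y, k.comp (ContinuousMap.mulRight y⁻¹) ∂P) x) x ∂lam
      = ∫ x, ∫ y, A.indicator 1 x * k (x * y⁻¹) ∂P ∂lam := by simp_rw [h1]
    _ = ∫ y, ∫ x, A.indicator 1 x * k (x * y⁻¹) ∂lam ∂P := integral_integral_swap hint1
    -- Right invariance: substitute `x ↦ x * y`.
    _ = ∫ y, ∫ x, A.indicator 1 (x * y) * k x ∂lam ∂P := by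
        congr 1 with y
        rw [← integral_mul_right_eq_self (μ := lam) (fun x => A.indicator 1 x * k (x * y⁻¹)) y]
        simp
    _ = ∫ x, ∫ y, A.indicator 1 (x * y) * k x ∂P ∂lam := integral_integral_swap hint2
    _ = ∫ x, k x * P.real ((x * ·) ⁻¹' A) ∂lam := by
        congr 1 with x
        rw [integral_mul_const, mul_comm, ← integral_indicator_one (measurable_const_mul x hA)]
        rfl

/-- Convolving `P` on the left with a mollifier supported in `V` averages translates of `P` that
differ from `P` by at most `t` on every set, and the result has a continuous density. -/
theorem exists_density_approx [lam.IsOpenPosMeasure] (P : Measure G) [IsProbabilityMeasure P]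
    {t : ℝ} {V : Set G} (hV : V ∈ 𝓝 (1 : G))
    (h : ∀ x ∈ V, ∀ A, MeasurableSet A → |P.real A - P.real ((x * ·) ⁻¹' A)| ≤ t)
    (hmeas : ∀ A, MeasurableSet A → Measurable fun x => P.real ((x * ·) ⁻¹' A)) :
    ∃ q : C(G, ℝ), 0 ≤ q ∧ ∀ A, MeasurableSet A →
      |P.real A - (FiniteMeasure.ofDensity lam q : Measure G).real A| ≤ t := by
  obtain ⟨k, hk⟩ := exists_isMollifier lam hV
  obtain ⟨q, hq, hqA⟩ := exists_density_convolution lam P hk.nonneg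
  refine ⟨q, hq, fun A hA => ?_⟩
  have hk0 : ∀ x, 0 ≤ k x := hk.nonneg
  have hki := k.integrable_of_isFiniteMeasure lam
  have hi : Integrable (fun x => k x * P.real ((x * ·) ⁻¹' A)) lam :=
    hki.mul_bdd (c := 1) (hmeas A hA).aestronglyMeasurable (Eventually.of_forall fun x => by
      rw [Real.norm_of_nonneg measureReal_nonneg]
      exact measureReal_le_one)
  have hP : P.real A = ∫ x, k x * P.real A ∂lam := by
    rw [integral_mul_const, hk.integral_eq_one, one_mul]
  rw [hqA A hA, hP, ← integral_sub (hki.mul_const _) hi]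
  rw [← Real.norm_eq_abs]
  calc ‖∫ x, k x * P.real A - k x * P.real ((x * ·) ⁻¹' A) ∂lam‖
      ≤ ∫ x, k x * t ∂lam := by
        refine norm_integral_le_of_norm_le (hki.mul_const t) (Eventually.of_forall fun x => ?_)
        rw [← mul_sub, norm_mul, Real.norm_of_nonneg (hk0 x)]
        by_cases hx : x ∈ V
        · exact mul_le_mul_of_nonneg_left (h x hx A hA) (hk0 x)
        · simp [hk.eq_zero x hx]
    _ = t := by rw [integral_mul_const, hk.integral_eq_one, one_mul]

end Approximation

/-! ### Unimodularity of compact groups. -/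

section CompactHaar

variable {G : Type*} [Group G] [TopologicalSpace G] [IsTopologicalGroup G] [CompactSpace G]
  [MeasurableSpace G] [BorelSpace G] (lam : Measure G) [lam.IsHaarMeasure]
  [IsProbabilityMeasure lam]

/-- A right translate of Haar measure is again a left Haar probability measure, and that is unique.
The same uniqueness gives invariance under inversion. -/
theorem MeasureTheory.Measure.IsHaarMeasure.isMulRightInvariant_of_compactSpace :
    lam.IsMulRightInvariant where
  map_mul_right_eq_self g := by
    have : IsProbabilityMeasure (lam.map (· * g)) :=
      Measure.isProbabilityMeasure_map (measurable_mul_const g).aemeasurable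
    exact Measure.isHaarMeasure_eq_of_isProbabilityMeasure _ _

theorem MeasureTheory.Measure.IsHaarMeasure.isInvInvariant_of_compactSpace :
    lam.IsInvInvariant where
  inv_eq_self := by
    have := Measure.IsHaarMeasure.isMulRightInvariant_of_compactSpace lam
    have : IsProbabilityMeasure lam.inv :=
      Measure.isProbabilityMeasure_map measurable_inv.aemeasurable
    have : lam.inv.IsOpenPosMeasure :=
      (Homeomorph.inv G).continuous.isOpenPosMeasure_map (Homeomorph.inv G).surjective
    have : lam.inv.IsHaarMeasure := {}
    exact Measure.isHaarMeasure_eq_of_isProbabilityMeasure _ _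

end CompactHaar

namespace Observable

/-! ### Translates are postprocessing equivalent. -/

section Translate

variable {H : Type*} [NormedAddCommGroup H] [InnerProductSpace ℂ H] [CompleteSpace H]
  {G : Type*} [Group G] [MeasurableSpace G] [MeasurableMul G]

theorem translate_apply (E : Observable G H) (x : G) (X : Set G) :
    E.translate x X = E ((fun h => h * x) ⁻¹' X) :=
  congrArg E (image_mul_right_inv x X)

theorem translate_one (E : Observable G H) : E.translate 1 = E := by
  ext1
  funext X
  rw [translate_apply]
  simp

theorem translate_translate (E : Observable G H) (x y : G) :
    (E.translate x).translate y = E.translate (x * y) := by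
  ext1
  funext X
  rw [translate_apply, translate_apply, translate_apply, ← preimage_comp]
  simp [Function.comp_def, mul_assoc]

theorem translate_isPostprocessingOf (E : Observable G H) (x : G) :
    (E.translate x).IsPostprocessingOf E := by
  have hx : Measurable fun h : G => h * x := measurable_mul_const x
  refine ⟨fun P => P.map hx.aemeasurable, fun s t _ p q r h => ?_, ?_⟩
  · change (r : Measure G).map _ = s • (p : Measure G).map _ + t • (q : Measure G).map _
    rw [h, Measure.map_add _ _ hx, Measure.map_smul, Measure.map_smul]
  · funext ρ
    refine Subtype.ext (Measure.ext fun X hX => ?_)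
    refine Eq.trans ?_ (Measure.map_apply hx hX).symm
    change (E.translate x).outcomeMeasure ρ X = E.outcomeMeasure ρ _
    rw [outcomeMeasure_apply _ _ hX, outcomeMeasure_apply _ _ (hx hX), translate_apply]

theorem postprocessingEquiv_translate (E : Observable G H) (x : G) :
    PostprocessingEquiv (E.translate x) E := by
  refine ⟨?_, translate_isPostprocessingOf E x⟩
  have h := translate_isPostprocessingOf (E.translate x) x⁻¹
  rwa [translate_translate, mul_inv_cancel, translate_one] at h

end Translate

/-! ### Rigidity of approximately sharp covariant observables. -/

section Rigidity

variable {G : Type*} [Group G] [TopologicalSpace G] [IsTopologicalGroup G]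
    [CompactSpace G] [MeasurableSpace G] [BorelSpace G]
    {H : Type*} [NormedAddCommGroup H] [InnerProductSpace ℂ H] [CompleteSpace H]
    {U : G →* unitary (H →L[ℂ] H)} {E F : Observable G H}

/-- If `E V` vanished, covariance would make every translate of `V` null; finitely many of them
cover `G`, contradicting total mass one. -/
theorem ne_zero_of_mem_covariant [Nontrivial H] (hE : E ∈ covariant U) {V : Set G}
    (hV : IsOpen V) (hne : V.Nonempty) : E V ≠ 0 := by
  intro h0
  obtain ⟨v, hv⟩ := exists_norm_eq H (zero_le_one (α := ℝ))
  have hnull : ∀ g : G,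
      (E.outcomeDistribution (QState.ofUnitVector v hv) : Measure G) (g • V) = 0 := fun g => by
      have h := hE g V hV.measurableSet
      rw [h0, mul_zero, zero_mul] at h
      have h2 := real_outcomeDistribution_ofUnitVector E v hv (hV.smul g).measurableSet
      rw [← h] at h2
      rw [← measureReal_eq_zero_iff, h2]
      simp
  obtain ⟨x, hx⟩ := hne
  obtain ⟨s, hs⟩ := isCompact_univ.elim_finite_subcover (fun g : G => g • V)
    (fun g => hV.smul g) (fun y _ => mem_iUnion.2 ⟨y * x⁻¹, x, hx, by simp⟩)
  have h1 : (E.outcomeDistribution (QState.ofUnitVector v hv) : Measure G) univ = 0 :=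
    measure_mono_null hs ((measure_biUnion_null_iff s.countable_toSet).2 fun g _ => hnull g)
  rw [measure_univ] at h1
  exact one_ne_zero h1

variable [T2Space G] [SecondCountableTopology G]

/-- Translating the distribution by `x` amounts to replacing `v` by `U x v`. Strong continuity makes
this close to `v`, so the distributions are close uniformly over all measurable sets. -/
theorem exists_density_approx_outcomeDistribution
    (hU : ∀ v : H, Continuous fun g => (U g : H →L[ℂ] H) v) (hE : E ∈ covariant U)
    (lam : Measure G) [IsProbabilityMeasure lam] [lam.IsMulRightInvariant] [lam.IsOpenPosMeasure]
    {v : H} (hv : ‖v‖ = 1) {t : ℝ} (ht : 0 < t) :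
    ∃ q : C(G, ℝ), 0 ≤ q ∧ ∀ A, MeasurableSet A →
      |(E.outcomeDistribution (QState.ofUnitVector v hv) : Measure G).real A -
        (FiniteMeasure.ofDensity lam q : Measure G).real A| ≤ t := by
  have hv' : ∀ x, ‖(U x : H →L[ℂ] H) v‖ = 1 := fun x => by rw [norm_unitary_apply, hv]
  have htrans : ∀ (x : G) (A : Set G), MeasurableSet A →
      (E.outcomeDistribution (QState.ofUnitVector v hv) : Measure G).real ((x * ·) ⁻¹' A) =
      (E.outcomeDistribution (QState.ofUnitVector _ (hv' x)) : Measure G).real A :=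
    fun x A hA => by
      rw [outcomeDistribution_unitary_apply hE x hv]
      exact (map_measureReal_apply (measurable_const_mul x) hA).symm
  have hV : ∀ᶠ x in 𝓝 (1 : G), 2 * ‖v - (U x : H →L[ℂ] H) v‖ < t := by
    have hc : Continuous fun x => 2 * ‖v - (U x : H →L[ℂ] H) v‖ :=
      continuous_const.mul (continuous_const.sub (hU v)).norm
    refine hc.tendsto 1 (Iio_mem_nhds ?_)
    simpa using ht
  refine exists_density_approx lam _ hV (fun x hx A hA => ?_) (fun A hA => ?_)
  · rw [htrans x A hA]
    exact (abs_real_outcomeDistribution_sub_le E hv (hv' x) hA).trans (le_of_lt hx)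
  · simp_rw [fun x => htrans x A hA,
      fun x => real_outcomeDistribution_ofUnitVector E _ (hv' x) hA]
    exact (Complex.continuous_re.comp
      ((hU v).inner ((E A).continuous.comp (hU v)))).measurable

/-- An approximately sharp covariant observable that is a postprocessing of a covariant observable
is a translate of it. -/
theorem eq_translate_of_isPostprocessingOf
    (hU : ∀ v : H, Continuous fun g => (U g : H →L[ℂ] H) v) (hE : E ∈ covariant U)
    (hsharp : E.IsApproximatelySharp) (hF : F ∈ covariant U) (h : E.IsPostprocessingOf F) :
    ∃ x, E = F.translate x := by
  -- The zero space has no unit vectors, but there all operators coincide.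
  rcases subsingleton_or_nontrivial H with hH | hH
  · exact ⟨1, Observable.ext (funext fun X => Subsingleton.elim _ _)⟩
  obtain ⟨Ψ, hΨ, hEF⟩ := h
  let lam : Measure G := Measure.haarMeasure ⊤
  have : IsProbabilityMeasure lam := ⟨Measure.haarMeasure_self⟩
  have : lam.IsMulRightInvariant :=
    Measure.IsHaarMeasure.isMulRightInvariant_of_compactSpace lam
  have : lam.IsInvInvariant := Measure.IsHaarMeasure.isInvInvariant_of_compactSpace lam
  obtain ⟨ν, hν, hconv⟩ := hΨ.exists_eq_mconv lam
  have key : ∀ v (hv : ‖v‖ = 1),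
      (E.outcomeDistribution (QState.ofUnitVector v hv) : Measure G) =
        (F.outcomeDistribution (QState.ofUnitVector v hv) : Measure G) ∗ₘ ν := fun v hv => by
    rw [hEF]
    -- Covariance of `F` translates the input of `Ψ` and covariance of `E` its output, so `Ψ`
    -- commutes with translations along this orbit.
    refine hconv _ (fun g => ?_) (fun t ht =>
      exists_density_approx_outcomeDistribution hU hF lam hv ht)
    have hv' : ‖(U g : H →L[ℂ] H) v‖ = 1 := by rw [norm_unitary_apply, hv]
    have hE' := fun ρ => congrFun hEF ρ
    simp only [Function.comp_apply] at hE'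
    rw [← outcomeDistribution_unitary_apply hF g hv hv', ← hE', ← hE',
      outcomeDistribution_unitary_apply hE g hv hv']
    rfl
  obtain ⟨x, rfl⟩ := exists_eq_dirac_of_concentrated ν fun V hVo hV1 ε hε => by
    obtain ⟨v, hv, hlt⟩ := exists_unitVector_of_norm_eq_one (E.nonneg' V hVo.measurableSet)
      (hsharp V hVo (ne_zero_of_mem_covariant hE hVo ⟨1, hV1⟩)) hε
    rw [← real_outcomeDistribution_ofUnitVector E v hv hVo.measurableSet, key v hv] at hlt
    exact exists_real_preimage_of_mconv _ ν hVo.measurableSet hlt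
  refine ⟨x, Observable.ext (funext fun X => ?_)⟩
  by_cases hX : MeasurableSet X
  · refine Eq.trans ?_ (translate_apply F x X).symm
    refine eq_of_outcomeDistribution_ofUnitVector_eq hX (measurable_mul_const x hX)
      fun v hv => ?_
    rw [key v hv, Measure.mconv_dirac, map_measureReal_apply (measurable_mul_const x) hX]
  · rw [E.not_measurable' X hX, (F.translate x).not_measurable' X hX]

end Rigidity

end Observable

theorem mainTheorem3 {G : Type*} [Group G] [TopologicalSpace G] [IsTopologicalGroup G]
    [CompactSpace G] [T2Space G] [SecondCountableTopology G] [MeasurableSpace G] [BorelSpace G]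
    {H : Type*} [NormedAddCommGroup H] [InnerProductSpace ℂ H] [CompleteSpace H]
    [TopologicalSpace.SeparableSpace H]
    (U : G →* unitary (H →L[ℂ] H)) (hU : ∀ v : H, Continuous fun g => (U g : H →L[ℂ] H) v)
    (E : Observable G H) (hE : E ∈ Observable.covariant U) (hsharp : E.IsApproximatelySharp) :
    Observable.IsPostprocessingClean U E ∧
      ∀ F ∈ Observable.covariant U,
        Observable.PostprocessingEquiv F E ↔ ∃ x : G, F = E.translate x := by
  -- Only one direction of the equivalence is used here, which is why the same statement yields
  -- cleanness.
  have key : ∀ F ∈ Observable.covariant U, E.IsPostprocessingOf F →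
      ∃ x : G, F = E.translate x := fun F hF h => by
    obtain ⟨x, hx⟩ := Observable.eq_translate_of_isPostprocessingOf hU hE hsharp hF h
    exact ⟨x⁻¹, by rw [hx, Observable.translate_translate, mul_inv_cancel,
      Observable.translate_one]⟩
  refine ⟨fun F hF h => ?_, fun F hF => ⟨fun h => key F hF h.1, ?_⟩⟩
  · obtain ⟨x, rfl⟩ := key F hF h
    exact (Observable.postprocessingEquiv_translate E x).symm
  · rintro ⟨x, rfl⟩
    exact Observable.postprocessingEquiv_translate E x
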